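/- A $d$-polytope is a $d$-dimensional convex hull of finitely many points in some $\mathbb{R}^n$; it is \emph{cubical} if the face lattice of each of its facets is isomorphic to the face lattice of a $(d-1)$-cube. A $4$-polytope $P$ is \emph{strongly $2$-linked} if its graph $G(P)$ (formed by the vertices and edges of $P$) has at least five vertices and, for every set $X$ of exactly five vertices of $P$ and every choice of two disjoint pairs $\{s_1,t_1\}$, $\{s_2,t_2\}$ of vertices in $X$, there are vertex-disjoint paths $L_1$ from $s_1$ to $t_1$ and $L_2$ from $s_2$ to $t_2$ in $G(P)$ that both avoid the fifth vertex of $X$. **Theorem (Strong linkedness of cubical 4-polytopes).** Every cubical $4$-polytope is strongly $2$-linked. Moreover, this fails for general $4$-polytopes: let a \emph{pyramid} over a polytope $Q$ be the convex hull of $Q$ and a point outside the affine hull of $Q$, let a \emph{two-fold pyramid} over $Q$ be a pyramid over a pyramid over $Q$, and let a \emph{quadrangle} be a $2$-polytope with four vertices. Then two-fold pyramids over quadrangles exist in $\mathbb{R}^4$, and every two-fold pyramid over a quadrangle is a $4$-polytope with six vertices that is not strongly $2$-linked. -/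

import Mathlib

namespace CubicalPolytope

/-- A (convex) polytope: the convex hull of finitely many points. -/
def IsPolytope {n : ℕ} (P : Set (EuclideanSpace ℝ (Fin n))) : Prop :=
  ∃ S : Finset (EuclideanSpace ℝ (Fin n)), P = convexHull ℝ (S : Set (EuclideanSpace ℝ (Fin n)))

/-- A nonempty set `P` has dimension `d` if its affine hull has dimension `d`. -/
def HasDim {n : ℕ} (d : ℕ) (P : Set (EuclideanSpace ℝ (Fin n))) : Prop :=
  P.Nonempty ∧ Module.finrank ℝ (vectorSpan ℝ P) = d

/-- A `d`-polytope is a polytope of dimension `d`. -/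
def IsDPolytope {n : ℕ} (d : ℕ) (P : Set (EuclideanSpace ℝ (Fin n))) : Prop :=
  IsPolytope P ∧ HasDim d P

/-- The faces of a polytope `P`, ordered by inclusion: the empty set and the sets of points of `P`
at which some linear functional attains its maximum over `P` (the zero functional gives `P`). -/
abbrev Face {n : ℕ} (P : Set (EuclideanSpace ℝ (Fin n))) : Type :=
  {F : Set (EuclideanSpace ℝ (Fin n)) // IsExposed ℝ P F}

/-- Combinatorial equivalence: the face lattices are isomorphic. -/
def CombEquiv {m n : ℕ} (P : Set (EuclideanSpace ℝ (Fin m)))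
    (Q : Set (EuclideanSpace ℝ (Fin n))) : Prop :=
  Nonempty (Face P ≃o Face Q)

/-- The standard cube `[0,1]^d`. -/
def stdCube (d : ℕ) : Set (EuclideanSpace ℝ (Fin d)) :=
  {x | ∀ i, 0 ≤ x i ∧ x i ≤ 1}

/-- A facet of a `d`-polytope is a face of dimension `d - 1`. A cubical `d`-polytope is a
`d`-polytope all of whose facets are combinatorially equivalent to the `(d - 1)`-cube. -/
def IsCubicalDPolytope {n : ℕ} (d : ℕ) (P : Set (EuclideanSpace ℝ (Fin n))) : Prop :=
  IsDPolytope d P ∧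
    ∀ F : Set (EuclideanSpace ℝ (Fin n)), IsExposed ℝ P F →
      ∀ e : ℕ, e + 1 = d → HasDim e F → CombEquiv F (stdCube e)

/-- The vertices of `P`: the points `v` such that `{v}` is a face of `P`. -/
abbrev vertexSet {n : ℕ} (P : Set (EuclideanSpace ℝ (Fin n))) :
    Set (EuclideanSpace ℝ (Fin n)) :=
  P.exposedPoints ℝ

/-- The graph of `P`: two distinct vertices are adjacent when the segment that joins them is a face
(an edge) of `P`. -/
def polytopeGraph {n : ℕ} (P : Set (EuclideanSpace ℝ (Fin n))) :
    SimpleGraph (vertexSet P) where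
  Adj u v := u ≠ v ∧ IsExposed ℝ P
    (segment ℝ (u : EuclideanSpace ℝ (Fin n)) (v : EuclideanSpace ℝ (Fin n)))
  symm := ⟨fun u v h => ⟨h.1.symm, by rw [segment_symm]; exact h.2⟩⟩
  loopless := ⟨fun _ h => h.1 rfl⟩

/-- For a `d`-polytope `P` and `k = ⌊(d + 1) / 2⌋`: `P` is strongly `k`-linked. The graph of `P` has
at least `d + 1` vertices and, for every set `X` of exactly `d + 1` vertices and every choice of `k`
disjoint pairs `{s i, t i}` in `X`, there are pairwise vertex-disjoint paths from `s i` to `t i`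
which avoid the vertices of `X` that are not paired. -/
def IsStronglyLinked {n : ℕ} (d k : ℕ) (P : Set (EuclideanSpace ℝ (Fin n))) : Prop :=
  ((d + 1 : ℕ) : ℕ∞) ≤ (vertexSet P).encard ∧
  ∀ X : Finset (vertexSet P), X.card = d + 1 →
    ∀ s t : Fin k → vertexSet P,
      Function.Injective (Sum.elim s t) → (∀ i, s i ∈ X) → (∀ i, t i ∈ X) →
      ∃ L : ∀ i, (polytopeGraph P).Path (s i) (t i),
        (∀ i j, i ≠ j → ∀ v, v ∈ (L i).1.support → v ∉ (L j).1.support) ∧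
        ∀ x ∈ X, (∀ i, x ≠ s i ∧ x ≠ t i) → ∀ i, x ∉ (L i).1.support

/-- A quadrangle: a 2-polytope with four vertices. -/
def IsQuadrangle {n : ℕ} (Q : Set (EuclideanSpace ℝ (Fin n))) : Prop :=
  IsDPolytope 2 Q ∧ (vertexSet Q).encard = 4

/-- `P` is a pyramid over `Q`: the convex hull of `Q` and a point outside the affine hull of `Q`. -/
def IsPyramid {n : ℕ} (P Q : Set (EuclideanSpace ℝ (Fin n))) : Prop :=
  ∃ a, a ∉ affineSpan ℝ Q ∧ P = convexHull ℝ (insert a Q)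

/-- `P` is a two-fold pyramid over `Q`: a pyramid over a pyramid over `Q`. -/
def IsTwoFoldPyramid {n : ℕ} (P Q : Set (EuclideanSpace ℝ (Fin n))) : Prop :=
  ∃ R, IsPyramid R Q ∧ IsPyramid P R

end CubicalPolytope

/-!
A polytope is handled through its vertex set `V`, a finite set in convex position. The simplex
method shows that two vertices on a closed side of a hyperplane are joined by a path which, apart
from its ends, stays strictly on that side, as long as some vertex lies strictly on that side.

Let `x, s, t, s', t'` be five vertices of a cubical `4`-polytope. Three points span at most a plane,
so there is a hyperplane through `x, s, t` and `s'`. If it properly cuts the polytope, then the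
path from `s` to `t` is taken on the side not containing `t'` and the path from `s'` to `t'` on the
other one. Otherwise `x, s, t, s'` lie in a facet. If the facet misses `t'`, then Balinski's theorem
joins `s` to `t` inside the facet while avoiding `x` and `s'`. If it contains all five vertices, the
graph of the `3`-cube has a path joining one of the pairs and avoiding the three other vertices. In
both cases the other pair is joined outside of the facet.

In a two-fold pyramid over a quadrangle, the diagonals of the quadrangle cross, hence are not edges.
If one apex is to be avoided, then paths joining the ends of both diagonals compete for the other
apex.
-/

namespace CubicalPolytope

/-! ### Paths in graphs -/

section Graph

variable {α β : Type*} {G H : SimpleGraph α} {S S' : Set α} {u v w : α}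

/-- `u` and `w` are joined by a walk of `G` all of whose vertices lie in `S`. -/
def JoinedWithin (G : SimpleGraph α) (S : Set α) (u w : α) : Prop :=
  ∃ p : G.Walk u w, ∀ z ∈ p.support, z ∈ S

lemma JoinedWithin.refl (hu : u ∈ S) : JoinedWithin G S u u :=
  ⟨.nil, by simpa using hu⟩

lemma JoinedWithin.symm (h : JoinedWithin G S u w) : JoinedWithin G S w u := by
  obtain ⟨p, hp⟩ := h
  exact ⟨p.reverse, fun z hz => hp z (by simpa using hz)⟩

lemma JoinedWithin.trans (huv : JoinedWithin G S u v) (hvw : JoinedWithin G S v w) :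
    JoinedWithin G S u w := by
  obtain ⟨p, hp⟩ := huv
  obtain ⟨q, hq⟩ := hvw
  exact ⟨p.append q, fun z hz => ((p.mem_support_append_iff q).1 hz).elim (hp z) (hq z)⟩

lemma JoinedWithin.of_adj (h : G.Adj u w) (hu : u ∈ S) (hw : w ∈ S) : JoinedWithin G S u w :=
  ⟨h.toWalk, by simp [hu, hw]⟩

lemma JoinedWithin.mem_right (h : JoinedWithin G S u w) : w ∈ S :=
  h.elim fun p hp => hp w p.end_mem_support

lemma JoinedWithin.mono (hGH : G ≤ H) (hS : S ⊆ S') (h : JoinedWithin G S u w) :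
    JoinedWithin H S' u w := by
  obtain ⟨p, hp⟩ := h
  exact ⟨p.mapLe hGH, fun z hz => hS (hp z (by simpa using hz))⟩

lemma JoinedWithin.map {K : SimpleGraph β} (φ : G →g K) {S : Set β}
    (h : JoinedWithin G (φ ⁻¹' S) u w) : JoinedWithin K S (φ u) (φ w) := by
  obtain ⟨p, hp⟩ := h
  refine ⟨p.map φ, fun z hz => ?_⟩
  obtain ⟨y, hy, rfl⟩ := List.mem_map.1 (p.support_map φ ▸ hz)
  exact hp y hy

lemma JoinedWithin.induce {V : Set α} (hV : ∀ u v, G.Adj u v → u ∈ V) {u w : V}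
    (h : JoinedWithin G S u w) : JoinedWithin (G.induce V) (Subtype.val ⁻¹' S) u w := by
  obtain ⟨p, hp⟩ := h
  have hpV : ∀ z ∈ p.support, z ∈ V := fun z hz => by
    obtain rfl | ⟨e, he, y, rfl⟩ := SimpleGraph.Walk.mem_support_iff_exists_mem_edges.1 hz
    · exact w.2
    · exact hV z y (p.edges_subset_edgeSet he)
  refine ⟨p.induce V hpV, fun z hz => ?_⟩
  rw [SimpleGraph.Walk.support_induce] at hz
  exact hp z (by simpa using hz)

/-- There are disjoint paths of `G` from `s` to `t` and from `s'` to `t'` which avoid `x`. -/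
def LinkedAvoiding (G : SimpleGraph α) (x s t s' t' : α) : Prop :=
  ∃ S S' : Set α, Disjoint S S' ∧ x ∉ S ∧ x ∉ S' ∧ JoinedWithin G S s t ∧ JoinedWithin G S' s' t'

lemma LinkedAvoiding.swap {x s t s' t' : α} (h : LinkedAvoiding G x s t s' t') :
    LinkedAvoiding G x s' t' s t := by
  obtain ⟨S, S', hdisj, hxS, hxS', hst, hst'⟩ := h
  exact ⟨S', S, hdisj.symm, hxS', hxS, hst', hst⟩

lemma LinkedAvoiding.induce {V : Set α} (hV : ∀ u v, G.Adj u v → u ∈ V) {x s t s' t' : V}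
    (h : LinkedAvoiding G (x : α) s t s' t') : LinkedAvoiding (G.induce V) x s t s' t' := by
  obtain ⟨S, S', hdisj, hxS, hxS', hst, hst'⟩ := h
  exact ⟨_, _, hdisj.preimage _, hxS, hxS', hst.induce hV, hst'.induce hV⟩

lemma JoinedWithin.exists_mem_of_not_adj (h : JoinedWithin G S u w) (huw : u ≠ w)
    (hadj : ¬ G.Adj u w) : ∃ z ∈ S, z ≠ u ∧ z ≠ w := by
  obtain ⟨p, hp⟩ := h
  cases p with
  | nil => exact absurd rfl huw
  | cons huv q =>
    refine ⟨_, hp _ (List.mem_cons_of_mem _ q.start_mem_support), huv.ne', ?_⟩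
    rintro rfl
    exact hadj huv

lemma not_linkedAvoiding_of_not_adj {a b s t s' t' : α}
    (hcover : ∀ z, z = a ∨ z = b ∨ z = s ∨ z = t ∨ z = s' ∨ z = t') (hst : s ≠ t)
    (hst' : s' ≠ t') (hadj : ¬ G.Adj s t) (hadj' : ¬ G.Adj s' t') :
    ¬ LinkedAvoiding G a s t s' t' := by
  rintro ⟨S, S', hdisj, haS, haS', hjoin, hjoin'⟩
  have hs := hjoin.symm.mem_right
  have ht := hjoin.mem_right
  have hs' := hjoin'.symm.mem_right
  have ht' := hjoin'.mem_right
  obtain ⟨z, hz, hzs, hzt⟩ := hjoin.exists_mem_of_not_adj hst hadj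
  obtain ⟨z', hz', hzs', hzt'⟩ := hjoin'.exists_mem_of_not_adj hst' hadj'
  rw [Set.disjoint_left] at hdisj
  have hzb : z = b := by grind [hcover z]
  have hzb' : z' = b := by grind [hcover z']
  exact hdisj hz (hzb ▸ hzb' ▸ hz')

end Graph

/-! ### Faces of the convex hull of a set of points -/

section ConvexHull

variable {E : Type*} [AddCommGroup E] [Module ℝ E] {V : Set E}

lemma eq_of_mem_affineSpan (l : E →ₗ[ℝ] ℝ) {c : ℝ} (h : ∀ v ∈ V, l v = c) {x : E}
    (hx : x ∈ affineSpan ℝ V) : l x = c :=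
  AffineMap.eqOn_affineSpan (f := l.toAffineMap) (g := AffineMap.const ℝ E c) h hx

lemma sep_convexHull_eq (l : E →ₗ[ℝ] ℝ) {c : ℝ} (hl : ∀ v ∈ V, l v ≤ c) :
    {x ∈ convexHull ℝ V | l x = c} = convexHull ℝ {v ∈ V | l v = c} := by
  set T := {v ∈ V | l v = c}
  apply Set.Subset.antisymm
  · suffices hsub : convexHull ℝ V ⊆ {x | l x ≤ c ∧ (l x = c → x ∈ convexHull ℝ T)} from
      fun x hx => (hsub hx.1).2 hx.2
    refine convexHull_min (fun v hv => ⟨hl v hv, fun hvc => subset_convexHull ℝ T ⟨hv, hvc⟩⟩) ?_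
    refine convex_iff_forall_pos.2 fun x hx y hy a b ha hb hab => ?_
    have hlxy : l (a • x + b • y) = c - (a * (c - l x) + b * (c - l y)) := by
      simp only [map_add, map_smul, smul_eq_mul]
      linear_combination c * hab
    have hax := mul_nonneg ha.le (sub_nonneg.2 hx.1)
    have hby := mul_nonneg hb.le (sub_nonneg.2 hy.1)
    refine ⟨by rw [hlxy]; linarith, fun heq => ?_⟩
    rw [hlxy] at heq
    have hx0 : c - l x = 0 := (mul_eq_zero.1 (by linarith)).resolve_left ha.ne'
    have hy0 : c - l y = 0 := (mul_eq_zero.1 (by linarith)).resolve_left hb.ne'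
    exact convex_convexHull ℝ T (hx.2 (by linarith)) (hy.2 (by linarith)) ha.le hb.le hab
  · exact fun x hx => ⟨convexHull_mono (Set.sep_subset _ _) hx,
      eq_of_mem_affineSpan l (fun v hv => hv.2) (convexHull_subset_affineSpan T hx)⟩

end ConvexHull

section ExposedSubset

variable {E : Type*} [AddCommGroup E] [Module ℝ E] [TopologicalSpace E] {V T U : Set E}

/-- `T` is the set of points of `V` on a supporting hyperplane of `V`, or all of `V`, or empty. For
finite `V` these sets encode the faces of the polytope `convexHull ℝ V`. -/
def IsExposedSubset (V T : Set E) : Prop :=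
  ∃ (l : E →L[ℝ] ℝ) (c : ℝ), (∀ v ∈ V, l v ≤ c) ∧ T = {v ∈ V | l v = c}

lemma IsExposedSubset.subset (h : IsExposedSubset V T) : T ⊆ V := by
  obtain ⟨l, c, -, rfl⟩ := h
  exact Set.sep_subset _ _

lemma IsExposedSubset.of_subset (hVU : IsExposedSubset V U) (hUT : U ⊆ T) (hTV : T ⊆ V) :
    IsExposedSubset T U := by
  obtain ⟨l, c, hl, rfl⟩ := hVU
  refine ⟨l, c, fun v hv => hl v (hTV hv), ?_⟩
  ext v
  exact ⟨fun hv => ⟨hUT hv, hv.2⟩, fun hv => ⟨hTV hv.1, hv.2⟩⟩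

/-- A functional exposing `U` in `T` is perturbed by a large multiple of one exposing `T` in `V`. -/
lemma IsExposedSubset.trans (hV : V.Finite) (hVT : IsExposedSubset V T)
    (hTU : IsExposedSubset T U) : IsExposedSubset V U := by
  obtain ⟨l, c, hl, rfl⟩ := hVT
  obtain ⟨k, d, hk, rfl⟩ := hTU
  obtain ⟨M, hM⟩ := (hV.image fun v => (k v - d) / (c - l v)).bddAbove
  have hbelow : ∀ v ∈ V, l v ≠ c → k v + (M + 1) * l v < d + (M + 1) * c := fun v hv hne => by
    have hpos : 0 < c - l v := sub_pos.2 ((hl v hv).lt_of_ne hne)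
    have hquot := (div_le_iff₀ hpos).1 (hM ⟨v, hv, rfl⟩)
    linarith
  refine ⟨k + (M + 1) • l, d + (M + 1) * c, fun v hv => ?_, ?_⟩
  · change k v + (M + 1) * l v ≤ _
    by_cases hvc : l v = c
    · rw [hvc]
      linarith [hk v ⟨hv, hvc⟩]
    · exact (hbelow v hv hvc).le
  · ext v
    change (v ∈ V ∧ l v = c) ∧ k v = d ↔ v ∈ V ∧ k v + (M + 1) * l v = d + (M + 1) * c
    constructor
    · rintro ⟨⟨hv, hvc⟩, hvd⟩
      exact ⟨hv, by rw [hvc, hvd]⟩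
    · rintro ⟨hv, heq⟩
      have hvc : l v = c := by
        by_contra hne
        exact (hbelow v hv hne).ne heq
      rw [hvc] at heq
      exact ⟨⟨hv, hvc⟩, by linarith⟩

lemma IsExposedSubset.mem_of_mem_affineSpan (h : IsExposedSubset V T) {v : E} (hv : v ∈ V)
    (hvT : v ∈ affineSpan ℝ T) : v ∈ T := by
  obtain ⟨l, c, -, rfl⟩ := h
  exact ⟨hv, eq_of_mem_affineSpan (l : E →ₗ[ℝ] ℝ) (fun w hw => hw.2) hvT⟩

lemma IsExposedSubset.disjoint_convexHull (hT : IsExposedSubset V T) (hUV : U ⊆ V)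
    (hTU : Disjoint T U) : Disjoint (convexHull ℝ T) (convexHull ℝ U) := by
  obtain ⟨l, c, hl, rfl⟩ := hT
  refine Set.disjoint_left.2 fun x hx hxU => ?_
  have hxc : l x = c := eq_of_mem_affineSpan (l : E →ₗ[ℝ] ℝ) (fun v hv => hv.2)
    (convexHull_subset_affineSpan _ hx)
  obtain ⟨v, hvU, hvc⟩ := convexHull_nonempty_iff.1
    ⟨x, (sep_convexHull_eq (l : E →ₗ[ℝ] ℝ) fun v hv => hl v (hUV hv)).le ⟨hxU, hxc⟩⟩
  exact Set.disjoint_left.1 hTU ⟨hUV hvU, hvc⟩ hvU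

lemma isExposed_convexHull_iff {F : Set E} :
    IsExposed ℝ (convexHull ℝ V) F ↔ ∃ T, IsExposedSubset V T ∧ F = convexHull ℝ T := by
  constructor
  · intro hF
    obtain rfl | ⟨x, hx⟩ := F.eq_empty_or_nonempty
    · exact ⟨∅, ⟨0, 1, by simp, by simp⟩, convexHull_empty.symm⟩
    obtain ⟨l, rfl⟩ := hF ⟨x, hx⟩
    have hle : ∀ v ∈ V, l v ≤ l x := fun v hv => hx.2 v (subset_convexHull ℝ V hv)
    refine ⟨{v ∈ V | l v = l x}, ⟨l, l x, hle, rfl⟩, ?_⟩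
    refine Eq.trans ?_ (sep_convexHull_eq (l : E →ₗ[ℝ] ℝ) hle)
    ext y
    exact ⟨fun hy => ⟨hy.1, (hx.2 y hy.1).antisymm (hy.2 x hx.1)⟩,
      fun hy => ⟨hy.1, fun z hz => (hx.2 z hz).trans hy.2.ge⟩⟩
  · rintro ⟨T, ⟨l, c, hl, rfl⟩, rfl⟩ ⟨x, hx⟩
    have hsep := sep_convexHull_eq (l : E →ₗ[ℝ] ℝ) hl
    have hle : ∀ y ∈ convexHull ℝ V, l y ≤ c :=
      convexHull_min hl (convex_halfSpace_le l.isLinear c)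
    refine ⟨l, hsep.symm.trans ?_⟩
    have hxc : l x = c := (hsep.ge hx).2
    ext y
    exact ⟨fun hy => ⟨hy.1, fun z hz => (hle z hz).trans hy.2.ge⟩,
      fun hy => ⟨hy.1, (hle y hy.1).antisymm (hxc.ge.trans (hy.2 x (hsep.ge hx).1))⟩⟩

/-- `V` is finite and each of its points is a vertex of `convexHull ℝ V`. -/
structure InConvexPosition (V : Set E) : Prop where
  finite : V.Finite
  isExposedSubset_singleton : ∀ v ∈ V, IsExposedSubset V {v}

lemma InConvexPosition.subset (hV : InConvexPosition V) (hTV : T ⊆ V) : InConvexPosition T where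
  finite := hV.finite.subset hTV
  isExposedSubset_singleton v hv :=
    (hV.isExposedSubset_singleton v (hTV hv)).of_subset (by simpa using hv) hTV

lemma InConvexPosition.mem_of_mem_convexHull (hV : InConvexPosition V) (hTV : T ⊆ V) {v : E}
    (hv : v ∈ V) (hvT : v ∈ convexHull ℝ T) : v ∈ T := by
  by_contra hv'
  have hdisj := (hV.isExposedSubset_singleton v hv).disjoint_convexHull hTV
    (Set.disjoint_singleton_left.2 hv')
  rw [convexHull_singleton] at hdisj
  exact Set.disjoint_singleton_left.1 hdisj hvT

lemma InConvexPosition.nontrivial_of_convexHull_inter (hV : InConvexPosition V) (hTV : T ⊆ V)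
    (hUV : U ⊆ V) (hTU : Disjoint T U) (h : (convexHull ℝ T ∩ convexHull ℝ U).Nonempty) :
    T.Nontrivial := by
  by_contra hT
  obtain rfl | ⟨v, rfl⟩ := (Set.not_nontrivial_iff.1 hT).eq_empty_or_singleton
  · simp at h
  · exact Set.not_disjoint_iff_nonempty_inter.2 h <|
      (hV.isExposedSubset_singleton v (hTV rfl)).disjoint_convexHull hUV hTU

lemma InConvexPosition.isExposed_convexHull_iff (hV : InConvexPosition V) (hTV : T ⊆ V) :
    IsExposed ℝ (convexHull ℝ V) (convexHull ℝ T) ↔ IsExposedSubset V T := by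
  refine CubicalPolytope.isExposed_convexHull_iff.trans ⟨?_, fun h => ⟨T, h, rfl⟩⟩
  rintro ⟨T', hT', heq⟩
  suffices T = T' from this ▸ hT'
  exact Set.Subset.antisymm
    (fun v hv => hV.mem_of_mem_convexHull hT'.subset (hTV hv) (heq ▸ subset_convexHull ℝ T hv))
    (fun v hv => hV.mem_of_mem_convexHull hTV (hT'.subset hv) (heq ▸ subset_convexHull ℝ T' hv))

lemma InConvexPosition.exposedPoints_convexHull (hV : InConvexPosition V) :
    (convexHull ℝ V).exposedPoints ℝ = V := by
  ext v
  rw [mem_exposedPoints_iff_exposed_singleton]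
  constructor
  · intro hv
    obtain ⟨T, hT, heq⟩ := CubicalPolytope.isExposed_convexHull_iff.1 hv
    obtain ⟨w, hw⟩ := convexHull_nonempty_iff.1 (heq ▸ Set.singleton_nonempty v)
    obtain rfl : w = v := heq.ge (subset_convexHull ℝ T hw)
    exact hT.subset hw
  · intro hv
    rw [← convexHull_singleton (𝕜 := ℝ) v, hV.isExposed_convexHull_iff (by simpa using hv)]
    exact hV.isExposedSubset_singleton v hv

lemma exists_inConvexPosition [T2Space E] [IsTopologicalAddGroup E] [ContinuousSMul ℝ E]
    [LocallyConvexSpace ℝ E] {S : Set E} (hS : S.Finite) :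
    ∃ V, InConvexPosition V ∧ convexHull ℝ V = convexHull ℝ S := by
  have hconv : Convex ℝ (convexHull ℝ S) := convex_convexHull ℝ S
  set V := (convexHull ℝ S).extremePoints ℝ
  have hV : V.Finite := hS.subset extremePoints_convexHull_subset
  refine ⟨V, ⟨hV, fun v hv => ?_⟩, ?_⟩
  · have hnotMem : v ∉ convexHull ℝ (V \ {v}) :=
      convexIndependent_set_iff_notMem_convexHull_sdiff.1 hconv.convexIndependent_extremePoints v hv
    obtain ⟨l, c, hl, hc⟩ := geometric_hahn_banach_closed_point (convex_convexHull ℝ _)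
      (hV.sdiff.isCompact_convexHull ℝ).isClosed hnotMem
    have hlt : ∀ w ∈ V, w ≠ v → l w < l v := fun w hw hne =>
      (hl w (subset_convexHull ℝ _ ⟨hw, hne⟩)).trans hc
    refine ⟨l, l v, fun w hw => ?_, ?_⟩
    · by_cases hwv : w = v
      · rw [hwv]
      · exact (hlt w hw hwv).le
    · ext w
      refine ⟨by rintro rfl; exact ⟨hv, rfl⟩, fun ⟨hw, hlw⟩ => ?_⟩
      by_contra hne
      exact (hlt w hw hne).ne hlw
  · rw [← (hV.isCompact_convexHull ℝ).isClosed.closure_eq]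
    exact closure_convexHull_extremePoints (hS.isCompact_convexHull ℝ) hconv

end ExposedSubset

/-! ### Edges and monotone paths -/

lemma exists_add_mul_le_of_finite {α : Type*} {V : Set α} (hV : V.Finite) {h k : α → ℝ} {c d : ℝ}
    (hc : ∀ v ∈ V, h v ≤ c) (hd : ∀ v ∈ V, h v = c → k v = d) (hne : ∃ v ∈ V, h v ≠ c) :
    ∃ r : ℝ, (∀ v ∈ V, k v + r * h v ≤ d + r * c) ∧
      ∃ q ∈ V, h q ≠ c ∧ k q + r * h q = d + r * c := by
  have hpos : ∀ v ∈ V, h v ≠ c → 0 < c - h v := fun v hv hvc => sub_pos.2 ((hc v hv).lt_of_ne hvc)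
  obtain ⟨q, ⟨hq, hqc⟩, hmax⟩ := Set.exists_max_image {v ∈ V | h v ≠ c}
    (fun v => (k v - d) / (c - h v)) (hV.sep _) hne
  refine ⟨(k q - d) / (c - h q), fun v hv => ?_, q, hq, hqc, ?_⟩
  · by_cases hvc : h v = c
    · rw [hvc, hd v hv hvc]
    · linarith [(div_le_iff₀ (hpos v hv hvc)).1 (hmax v ⟨hv, hvc⟩)]
  · linarith [div_mul_cancel₀ (k q - d) (hpos q hq hqc).ne']

section Edges

variable {E : Type*} [AddCommGroup E] [Module ℝ E] [TopologicalSpace E] {V T : Set E} {v : E}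

lemma IsExposedSubset.exists_functional_singleton (h : IsExposedSubset V {v}) :
    ∃ l : E →L[ℝ] ℝ, (∀ w ∈ V, l w ≤ l v) ∧ ∀ w ∈ V, w ≠ v → l w < l v := by
  obtain ⟨l, c, hl, heq⟩ := h
  obtain rfl : l v = c := (heq.le (Set.mem_singleton v)).2
  exact ⟨l, hl, fun w hw hne => (hl w hw).lt_of_ne fun hwv => hne (heq.ge ⟨hw, hwv⟩)⟩

lemma isExposedSubset_add_mul (h k : E →L[ℝ] ℝ) {r c : ℝ} (hle : ∀ v ∈ V, k v + r * h v ≤ c) :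
    IsExposedSubset V {v ∈ V | k v + r * h v = c} :=
  ⟨k + r • h, c, hle, rfl⟩

lemma InConvexPosition.exists_eq_pair_of_minimal (hT : InConvexPosition T) (hv : v ∈ T)
    (hTv : T ≠ {v}) (hmin : ∀ T', IsExposedSubset T T' → v ∈ T' → T' ≠ {v} → T' = T) :
    ∃ u, v ≠ u ∧ T = {v, u} := by
  obtain ⟨h, hle, hh⟩ := (hT.isExposedSubset_singleton v hv).exists_functional_singleton
  have hproportional (k : E →L[ℝ] ℝ) : ∃ r : ℝ, ∀ p ∈ T, k p + r * h p = k v + r * h v := by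
    obtain ⟨w, hw, hwv⟩ := (Set.nontrivial_iff_ne_singleton hv).2 hTv |>.exists_ne v
    obtain ⟨r, hr, q, hq, hqv, heq⟩ := exists_add_mul_le_of_finite hT.finite (k := k) hle
      (fun p hp hpv => by rw [by_contra fun hne => (hh p hp hne).ne hpv]) ⟨w, hw, (hh w hw hwv).ne⟩
    have hface := hmin _ (isExposedSubset_add_mul h k hr) ⟨hv, rfl⟩ fun hsing => by
      obtain rfl : q = v := hsing.le ⟨hq, heq⟩
      exact hqv rfl
    exact ⟨r, fun p hp => (hface.ge hp).2⟩
  have hlt : ∀ u ∈ T, ∀ w ∈ T, u ≠ v → w ≠ u → h u < h w := by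
    intro u hu w hw huv hwu
    obtain ⟨k, -, hk⟩ := (hT.isExposedSubset_singleton u hu).exists_functional_singleton
    obtain ⟨r, hr⟩ := hproportional k
    have hrpos : 0 < r := by
      by_contra! hr0
      nlinarith [hr u hu, hk v hv huv.symm, hh u hu huv]
    nlinarith [hr u hu, hr w hw, hk w hw hwu]
  obtain ⟨u, hu, huv⟩ := (Set.nontrivial_iff_ne_singleton hv).2 hTv |>.exists_ne v
  refine ⟨u, huv.symm, Set.Subset.antisymm (fun w hw => ?_) (Set.pair_subset hv hu)⟩
  by_contra! hne
  simp only [Set.mem_insert_iff, Set.mem_singleton_iff, not_or] at hne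
  exact lt_asymm (hlt u hu w hw huv hne.2) (hlt w hw u hu hne.1 (Ne.symm hne.2))

lemma InConvexPosition.exists_isExposedSubset_improving (hV : InConvexPosition V)
    (f : E →L[ℝ] ℝ) (hv : v ∈ V) (hf : ∃ w ∈ V, f v < f w) :
    ∃ T, IsExposedSubset V T ∧ v ∈ T ∧ T ≠ {v} ∧ ∀ p ∈ T, p ≠ v → f v < f p := by
  obtain ⟨h, hle, hh⟩ := (hV.isExposedSubset_singleton v hv).exists_functional_singleton
  obtain ⟨w, hw, hvw⟩ := hf
  have hwv : w ≠ v := by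
    rintro rfl
    exact lt_irrefl _ hvw
  obtain ⟨r, hr, q, hq, hqv, heq⟩ := exists_add_mul_le_of_finite hV.finite (k := f) hle
    (fun p hp hpv => by rw [by_contra fun hne => (hh p hp hne).ne hpv]) ⟨w, hw, (hh w hw hwv).ne⟩
  have hrpos : 0 < r := by
    by_contra! hr0
    nlinarith [hr w hw, hh w hw hwv]
  refine ⟨_, isExposedSubset_add_mul h f hr, ⟨hv, rfl⟩, fun hsing => ?_, fun p hp hpv => ?_⟩
  · obtain rfl : q = v := hsing.le ⟨hq, heq⟩
    exact hqv rfl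
  · nlinarith [hp.2, hh p hp.1 hpv]

/-- The graph formed by the vertices and edges of `convexHull ℝ V`, as a graph on the ambient
space, in which the points outside `V` are isolated. -/
def edgeGraph (V : Set E) : SimpleGraph E where
  Adj u v := u ≠ v ∧ IsExposedSubset V {u, v}
  symm := ⟨fun u v h => ⟨h.1.symm, Set.pair_comm u v ▸ h.2⟩⟩
  loopless := ⟨fun _ h => h.1 rfl⟩

lemma edgeGraph_mono (hV : V.Finite) (hVT : IsExposedSubset V T) : edgeGraph T ≤ edgeGraph V :=
  fun _ _ h => ⟨h.1, hVT.trans hV h.2⟩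

/-- A step of the simplex method: on a minimal face among those on which `v` is the only minimum of
`f`, the vertex `v` has a single neighbour. -/
lemma InConvexPosition.exists_adj_lt (hV : InConvexPosition V) (f : E →L[ℝ] ℝ) (hv : v ∈ V)
    (hf : ∃ w ∈ V, f v < f w) : ∃ u, (edgeGraph V).Adj v u ∧ f v < f u := by
  obtain ⟨T, ⟨hT, hvT, hTv, hfT⟩, hmin⟩ := Set.Finite.exists_minimal
    (hV.finite.finite_subsets.subset fun T hT => hT.1.subset)
    (hV.exists_isExposedSubset_improving f hv hf)
  obtain ⟨u, hvu, rfl⟩ := (hV.subset hT.subset).exists_eq_pair_of_minimal hvT hTv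
    fun T' hT' hvT' hT'v => Set.Subset.antisymm hT'.subset <|
      hmin ⟨hT.trans hV.finite hT', hvT', hT'v, fun p hp => hfT p (hT'.subset hp)⟩ hT'.subset
  exact ⟨u, ⟨hvu, hT⟩, hfT u (by simp) hvu.symm⟩

lemma edgeGraph_adj_mem {u w : E} (h : (edgeGraph V).Adj u w) : w ∈ V :=
  h.2.subset (by simp)

lemma InConvexPosition.exists_joinedWithin_max (hV : InConvexPosition V) (f : E →L[ℝ] ℝ)
    (hv : v ∈ V) : ∃ m ∈ V, (∀ w ∈ V, f w ≤ f m) ∧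
      JoinedWithin (edgeGraph V) (insert v {p ∈ V | f v < f p}) v m := by
  set S := insert v {p ∈ V | f v < f p}
  obtain ⟨m, ⟨hm, hjoin⟩, hmax⟩ := Set.exists_max_image
    {p ∈ V | JoinedWithin (edgeGraph V) S v p} f (hV.finite.sep _)
    ⟨v, hv, .refl (Set.mem_insert _ _)⟩
  refine ⟨m, hm, ?_, hjoin⟩
  by_contra! hlt
  obtain ⟨u, hmu, hfu⟩ := hV.exists_adj_lt f hm hlt
  have hu : u ∈ V := edgeGraph_adj_mem hmu
  have huS : u ∈ S := .inr ⟨hu, (hmax v ⟨hv, .refl (Set.mem_insert _ _)⟩).trans_lt hfu⟩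
  exact (hmax u ⟨hu, hjoin.trans (.of_adj hmu hjoin.mem_right huS)⟩).not_gt hfu

lemma InConvexPosition.joinedWithin_max (hV : InConvexPosition V) (f : E →L[ℝ] ℝ) {m : E}
    {a : ℝ} (hv : v ∈ V) (hav : a ≤ f v) (hm : m ∈ V) (ham : a < f m)
    (hmax : ∀ w ∈ V, f w ≤ f m) :
    JoinedWithin (edgeGraph V) (insert v {p ∈ V | a < f p}) v m := by
  obtain ⟨m', hm', hmax', hjoin⟩ := hV.exists_joinedWithin_max f hv
  replace hjoin := hjoin.mono (S' := insert v {p ∈ V | a < f p}) le_rfl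
    (Set.insert_subset_insert fun p hp => ⟨hp.1, hav.trans_lt hp.2⟩)
  have hface : IsExposedSubset V {p ∈ V | f p = f m} := ⟨f, f m, hmax, rfl⟩
  have hF := hV.subset hface.subset
  obtain ⟨k, -, hk⟩ := (hV.isExposedSubset_singleton m hm).exists_functional_singleton
  obtain ⟨m'', hm'', hmax'', hjoin'⟩ := hF.exists_joinedWithin_max k
    (v := m') ⟨hm', (hmax m' hm').antisymm (hmax' m hm)⟩
  obtain rfl : m'' = m := by
    by_contra hne
    exact (hk m'' hm''.1 hne).not_ge (hmax'' m ⟨hm, rfl⟩)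
  refine hjoin.trans (hjoin'.mono (edgeGraph_mono hV.finite hface) ?_)
  rintro p (rfl | ⟨hp, -⟩)
  · exact hjoin.mem_right
  · exact .inr ⟨hp.1, ham.trans_eq hp.2.symm⟩

lemma InConvexPosition.joinedWithin_halfSpace (hV : InConvexPosition V) (f : E →L[ℝ] ℝ) {a : ℝ}
    (ha : ∃ q ∈ V, a < f q) {s t : E} (hs : s ∈ V) (ht : t ∈ V) (has : a ≤ f s) (hat : a ≤ f t) :
    JoinedWithin (edgeGraph V) ({s, t} ∪ {p ∈ V | a < f p}) s t := by
  obtain ⟨q, hq, haq⟩ := ha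
  obtain ⟨m, hm, hmax⟩ := Set.exists_max_image V f hV.finite ⟨q, hq⟩
  have ham : a < f m := haq.trans_le (hmax q hq)
  have hsm := hV.joinedWithin_max f hs has hm ham hmax
  have htm := hV.joinedWithin_max f ht hat hm ham hmax
  exact (hsm.mono le_rfl (by grind)).trans (htm.mono le_rfl (by grind)).symm

end Edges

/-! ### Facets -/

lemma finrank_vectorSpan_insert_of_notMem {k V P : Type*} [DivisionRing k] [AddCommGroup V]
    [Module k V] [AddTorsor V P] {S : Set P} (hS : S.Nonempty)
    [FiniteDimensional k (vectorSpan k S)] {a : P} (ha : a ∉ affineSpan k S) :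
    Module.finrank k (vectorSpan k (insert a S)) = Module.finrank k (vectorSpan k S) + 1 := by
  refine (finrank_vectorSpan_insert_le_set k S a).antisymm (Submodule.finrank_lt_finrank_of_lt ?_)
  refine (vectorSpan_mono k (Set.subset_insert a S)).lt_of_not_ge fun hle => ha ?_
  obtain ⟨s, hs⟩ := hS
  have hsub : a -ᵥ s ∈ vectorSpan k S :=
    hle (vsub_mem_vectorSpan k (Set.mem_insert a S) (Set.mem_insert_of_mem a hs))
  rw [← vsub_vadd a s]
  exact vadd_mem_affineSpan_of_mem_affineSpan_of_mem_vectorSpan (mem_affineSpan k hs) hsub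

section Facets

variable {E : Type*} [AddCommGroup E] [Module ℝ E] [TopologicalSpace E] {V A T : Set E}

lemma IsExposedSubset.finrank_vectorSpan_add_one_le (hV : V.Finite) (hT : IsExposedSubset V T)
    (hne : T.Nonempty) (hTV : T ≠ V) :
    Module.finrank ℝ (vectorSpan ℝ T) + 1 ≤ Module.finrank ℝ (vectorSpan ℝ V) := by
  have := finiteDimensional_vectorSpan_of_finite ℝ (hV.subset hT.subset)
  have := finiteDimensional_vectorSpan_of_finite ℝ hV
  obtain ⟨q, hq, hqT⟩ := Set.exists_of_ssubset (hT.subset.ssubset_of_ne hTV)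
  rw [← finrank_vectorSpan_insert_of_notMem hne fun h => hqT (hT.mem_of_mem_affineSpan hq h)]
  exact Submodule.finrank_mono (vectorSpan_mono ℝ (Set.insert_subset hq hT.subset))

/-- `F` is the vertex set of a facet of `convexHull ℝ V`. -/
structure IsFacet (V F : Set E) : Prop where
  isExposedSubset : IsExposedSubset V F
  nonempty : F.Nonempty
  finrank_add_one : Module.finrank ℝ (vectorSpan ℝ F) + 1 = Module.finrank ℝ (vectorSpan ℝ V)

variable [SeparatingDual ℝ E]

lemma exists_functional_of_notMem {W : Submodule ℝ E} [FiniteDimensional ℝ W] {x : E}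
    (hx : x ∉ W) : ∃ l : E →L[ℝ] ℝ, (∀ w ∈ W, l w = 0) ∧ 0 < l x := by
  set X := W ⊔ Submodule.span ℝ {x}
  have hxX : x ∈ X := Submodule.mem_sup_right (Submodule.mem_span_singleton_self x)
  obtain ⟨g, hgx, hg⟩ := Submodule.exists_le_ker_of_notMem
    (show (⟨x, hxX⟩ : X) ∉ W.comap X.subtype from hx)
  obtain ⟨l, hl⟩ := SeparatingDual.dualMap_surjective_iff.2 X.subtype_injective g
  have hlX (y : X) : l y = g y := DFunLike.congr_fun hl y
  have hlW : ∀ w ∈ W, l w = 0 := fun w hw =>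
    (hlX ⟨w, Submodule.mem_sup_left hw⟩).trans (hg hw)
  obtain hneg | hpos := ((hlX ⟨x, hxX⟩).trans_ne hgx).lt_or_gt
  · exact ⟨-l, fun w hw => by simp [hlW w hw], by simpa using hneg⟩
  · exact ⟨l, hlW, hpos⟩

lemma exists_functional_of_notMem_affineSpan [FiniteDimensional ℝ (vectorSpan ℝ A)] {x : E}
    (hx : x ∉ affineSpan ℝ A) : ∃ (l : E →L[ℝ] ℝ) (c : ℝ), (∀ v ∈ A, l v = c) ∧ c < l x := by
  obtain rfl | ⟨a, ha⟩ := A.eq_empty_or_nonempty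
  · exact ⟨0, -1, by simp, by simp⟩
  have hxa : x - a ∉ vectorSpan ℝ A := fun hmem => hx <| by
    simpa using vadd_mem_affineSpan_of_mem_affineSpan_of_mem_vectorSpan (mem_affineSpan ℝ ha) hmem
  obtain ⟨l, hl, hlx⟩ := exists_functional_of_notMem hxa
  refine ⟨l, l a, fun v hv => ?_, by simpa using hlx⟩
  simpa [sub_eq_zero] using hl (v - a) (vsub_mem_vectorSpan ℝ hv ha)

lemma exists_functional_of_finrank_lt [FiniteDimensional ℝ (vectorSpan ℝ A)]
    (h : Module.finrank ℝ (vectorSpan ℝ A) < Module.finrank ℝ (vectorSpan ℝ V)) :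
    ∃ (l : E →L[ℝ] ℝ) (c : ℝ), (∀ v ∈ A, l v = c) ∧ ∃ v ∈ V, c < l v := by
  obtain ⟨v, hv, hvA⟩ : ∃ v ∈ V, v ∉ affineSpan ℝ A := by
    by_contra! hsub
    have hle := AffineSubspace.direction_le (affineSpan_le.2 hsub)
    rw [direction_affineSpan, direction_affineSpan] at hle
    exact h.not_ge (Submodule.finrank_mono hle)
  obtain ⟨l, c, hl, hlv⟩ := exists_functional_of_notMem_affineSpan hvA
  exact ⟨l, c, hl, v, hv, hlv⟩

/-- Balinski's argument: one of the two half-spaces bounded by a hyperplane through `A` and `s`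
contains `t`, and a monotone path in it avoids `A`. -/
lemma InConvexPosition.joinedWithin_diff (hV : InConvexPosition V) (hA : A.Finite) {s t : E}
    (hdim : Module.finrank ℝ (vectorSpan ℝ (insert s A)) < Module.finrank ℝ (vectorSpan ℝ V))
    (hs : s ∈ V \ A) (ht : t ∈ V \ A) : JoinedWithin (edgeGraph V) (V \ A) s t := by
  have := finiteDimensional_vectorSpan_of_finite ℝ (hA.insert s)
  obtain ⟨l, c, hl, v, hv, hcv⟩ := exists_functional_of_finrank_lt hdim
  have hls : l s = c := hl s (Set.mem_insert s A)
  have hlA : ∀ p ∈ A, l p = c := fun p hp => hl p (Set.mem_insert_of_mem s hp)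
  obtain hct | htc := le_or_gt c (l t)
  · refine (hV.joinedWithin_halfSpace l ⟨v, hv, hcv⟩ hs.1 ht.1 hls.ge hct).mono le_rfl ?_
    rintro p ((rfl | rfl) | ⟨hp, hcp⟩)
    exacts [hs, ht, ⟨hp, fun hpA => hcp.ne' (hlA p hpA)⟩]
  · refine (hV.joinedWithin_halfSpace (-l) ⟨t, ht.1, neg_lt_neg htc⟩ hs.1 ht.1
      (neg_le_neg hls.le) (neg_le_neg htc.le)).mono le_rfl ?_
    rintro p ((rfl | rfl) | ⟨hp, hcp⟩)
    exacts [hs, ht, ⟨hp, fun hpA => (neg_lt_neg_iff.1 hcp).ne (hlA p hpA)⟩]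

/-- A maximal proper face is a facet: a supporting hyperplane through a face of smaller dimension
can be tilted around it, about one more point of `V`, until it meets `V` in a larger proper face. -/
lemma IsExposedSubset.exists_isFacet_superset (hV : V.Finite) (hT : IsExposedSubset V T)
    (hne : T.Nonempty) (hTV : T ≠ V) : ∃ F, IsFacet V F ∧ T ⊆ F := by
  obtain ⟨F, ⟨hF, hTF, hFV⟩, hmax⟩ := Set.Finite.exists_maximal
    (s := {F | IsExposedSubset V F ∧ T ⊆ F ∧ F ≠ V})
    (hV.finite_subsets.subset fun F hF => hF.1.subset) ⟨T, hT, le_rfl, hTV⟩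
  have hle := hF.finrank_vectorSpan_add_one_le hV (hne.mono hTF) hFV
  refine ⟨F, ⟨hF, hne.mono hTF, hle.eq_of_not_lt fun hlt => ?_⟩, hTF⟩
  obtain ⟨q, hq, hqF⟩ := Set.exists_of_ssubset (hF.subset.ssubset_of_ne hFV)
  have := finiteDimensional_vectorSpan_of_finite ℝ ((hV.subset hF.subset).insert q)
  obtain ⟨k, d, hk, v, hv, hdv⟩ := exists_functional_of_finrank_lt
    ((finrank_vectorSpan_insert_le_set ℝ F q).trans_lt hlt)
  obtain ⟨h, c, hh, rfl⟩ := id hF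
  have hqc : h q ≠ c := fun hqc => hqF ⟨hq, hqc⟩
  obtain ⟨r, hr, p, hp, hpc, heq⟩ := exists_add_mul_le_of_finite hV hh
    (fun w hw hwc => hk w (.inr ⟨hw, hwc⟩)) ⟨q, hq, hqc⟩
  have htilt : {w ∈ V | k w + r * h w = d + r * c} = V := by
    by_contra hproper
    have hsub : {w ∈ V | h w = c} ⊆ {w ∈ V | k w + r * h w = d + r * c} := fun w hw =>
      ⟨hw.1, by rw [hk w (.inr hw), hw.2]⟩
    exact hpc (hmax ⟨isExposedSubset_add_mul h k hr, hTF.trans hsub, hproper⟩ hsub ⟨hp, heq⟩).2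
  have hq0 := (htilt.ge hq).2
  have hr0 : r = 0 := by
    rw [hk q (Set.mem_insert _ _), add_right_inj] at hq0
    by_contra hr
    exact hqc (mul_left_cancel₀ hr hq0)
  have hv0 := (htilt.ge hv).2
  simp only [hr0, zero_mul, add_zero] at hv0
  exact hdv.ne' hv0

lemma exists_hyperplane_or_isFacet (hV : V.Finite) (hAV : A ⊆ V) (hA : A.Nonempty)
    (hdim : Module.finrank ℝ (vectorSpan ℝ A) + 1 < Module.finrank ℝ (vectorSpan ℝ V)) (y : E)
    {z : E} (hz : z ∈ V) :
    (∃ (f : E →L[ℝ] ℝ) (a : ℝ), (∀ v ∈ A, f v = a) ∧ a ≤ f y ∧ a ≤ f z ∧ (∃ q ∈ V, a < f q) ∧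
      ∃ q ∈ V, f q < a) ∨ ∃ F, IsFacet V F ∧ A ⊆ F := by
  have := finiteDimensional_vectorSpan_of_finite ℝ ((hV.subset hAV).insert y)
  obtain ⟨f, a, hf, ⟨q, hq, hqa⟩, haz⟩ : ∃ (f : E →L[ℝ] ℝ) (a : ℝ),
      (∀ v ∈ insert y A, f v = a) ∧ (∃ q ∈ V, f q ≠ a) ∧ a ≤ f z := by
    obtain ⟨f, a, hf, q, hq, haq⟩ := exists_functional_of_finrank_lt
      ((finrank_vectorSpan_insert_le_set ℝ A y).trans_lt hdim)
    obtain haz | hza := le_or_gt a (f z)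
    · exact ⟨f, a, hf, ⟨q, hq, haq.ne'⟩, haz⟩
    · exact ⟨-f, -a, fun v hv => neg_inj.2 (hf v hv), ⟨z, hz, (neg_lt_neg hza).ne'⟩,
        (neg_lt_neg hza).le⟩
  have hfA : ∀ v ∈ A, f v = a := fun v hv => hf v (Set.mem_insert_of_mem y hv)
  have hfacet (hface : IsExposedSubset V {v ∈ V | f v = a}) : ∃ F, IsFacet V F ∧ A ⊆ F := by
    have hsub : A ⊆ {v ∈ V | f v = a} := fun v hv => ⟨hAV hv, hfA v hv⟩
    obtain ⟨F, hF, hle⟩ := hface.exists_isFacet_superset hV (hA.mono hsub)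
      fun heq => hqa (heq.ge hq).2
    exact ⟨F, hF, hsub.trans hle⟩
  by_cases hbelow : ∀ v ∈ V, f v ≤ a
  · exact .inr (hfacet ⟨f, a, hbelow, rfl⟩)
  by_cases habove : ∀ v ∈ V, a ≤ f v
  · exact .inr (hfacet ⟨-f, -a, fun v hv => neg_le_neg (habove v hv), by simp⟩)
  push Not at hbelow habove
  exact .inl ⟨f, a, hfA, (hf y (Set.mem_insert y A)).ge, haz, hbelow, habove⟩

end Facets

/-! ### Linking pairs of vertices -/

/-- Among any five points of `F`, one of two disjoint pairs is joined by a path of `G` in `F` which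
avoids the other three points. This is weaker than linkedness and already holds for the `3`-cube. -/
def HasAvoidingPath {α : Type*} (G : SimpleGraph α) (F : Set α) : Prop :=
  ∀ x s t s' t', [x, s, t, s', t'].Nodup → {x, s, t, s', t'} ⊆ F →
    JoinedWithin G (F \ {x, s', t'}) s t ∨ JoinedWithin G (F \ {x, s, t}) s' t'

lemma HasAvoidingPath.map {α β : Type*} {G : SimpleGraph α} {K : SimpleGraph β} {F : Set α}
    (h : HasAvoidingPath G F) (φ : G →g K) (hφ : Function.Injective φ) :
    HasAvoidingPath K (φ '' F) := by
  have hpath : ∀ {s t x y z}, JoinedWithin G (F \ {x, y, z}) s t →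
      JoinedWithin K (φ '' F \ {φ x, φ y, φ z}) (φ s) (φ t) := fun hst =>
    JoinedWithin.map φ (hst.mono le_rfl fun v hv =>
      ⟨⟨v, hv.1, rfl⟩, by simpa [hφ.eq_iff] using hv.2⟩)
  intro x s t s' t' hnodup hmem
  simp only [Set.insert_subset_iff, Set.singleton_subset_iff] at hmem
  obtain ⟨⟨x, hx, rfl⟩, ⟨s, hs, rfl⟩, ⟨t, ht, rfl⟩, ⟨s', hs', rfl⟩, ⟨t', ht', rfl⟩⟩ := hmem
  refine (h x s t s' t' (List.Nodup.of_map φ hnodup) ?_).imp hpath hpath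
  simp [Set.insert_subset_iff, hx, hs, ht, hs', ht']

section Linking

variable {E : Type*} [AddCommGroup E] [Module ℝ E] [TopologicalSpace E] {V F : Set E}
  {x s t s' t' : E}

/-- The two paths run on different sides of the hyperplane. -/
lemma InConvexPosition.linkedAvoiding_of_hyperplane (hV : InConvexPosition V) (f : E →L[ℝ] ℝ)
    {a : ℝ} (habove : ∃ q ∈ V, a < f q) (hbelow : ∃ q ∈ V, f q < a)
    (hnodup : [x, s, t, s', t'].Nodup) (hmem : {x, s, t, s', t'} ⊆ V)
    (hxst : ∀ v ∈ ({x, s, t} : Set E), f v = a) (hs' : a ≤ f s') (ht' : a ≤ f t') :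
    LinkedAvoiding (edgeGraph V) x s t s' t' := by
  obtain ⟨q, hq, hqa⟩ := hbelow
  have hx : f x = a := hxst x (by simp)
  have hs : f s = a := hxst s (by simp)
  have ht : f t = a := hxst t (by simp)
  refine ⟨_, _, ?_, ?_, ?_,
    hV.joinedWithin_halfSpace (-f) ⟨q, hq, neg_lt_neg hqa⟩ (hmem (by simp)) (hmem (by simp))
      (neg_le_neg hs.le) (neg_le_neg ht.le),
    hV.joinedWithin_halfSpace f habove (hmem (by simp)) (hmem (by simp)) hs' ht'⟩
  · rw [Set.disjoint_left]
    rintro p (hp | ⟨-, hp⟩) (hp' | ⟨-, hp'⟩)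
    · grind
    · grind
    · have := neg_lt_neg_iff.1 hp
      grind
    · exact lt_asymm hp' (neg_lt_neg_iff.1 hp)
  · rintro (hp | ⟨-, hp⟩)
    · grind
    · exact (neg_lt_neg_iff.1 hp).ne hx
  · rintro (hp | ⟨-, hp⟩)
    · grind
    · exact hp.ne' hx

lemma InConvexPosition.linkedAvoiding_of_face (hV : InConvexPosition V)
    (hF : IsExposedSubset V F) (hFV : F ≠ V) (hxF : x ∈ F) (hxs' : x ≠ s') (hxt' : x ≠ t')
    (hs' : s' ∈ V) (ht' : t' ∈ V) (hst : JoinedWithin (edgeGraph F) (F \ {x, s', t'}) s t) :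
    LinkedAvoiding (edgeGraph V) x s t s' t' := by
  obtain ⟨q, hq, hqF⟩ := Set.exists_of_ssubset (hF.subset.ssubset_of_ne hFV)
  have hmono := edgeGraph_mono hV.finite hF
  obtain ⟨g, c, hg, rfl⟩ := hF
  have hqc : g q < c := (hg q hq).lt_of_ne fun h => hqF ⟨hq, h⟩
  refine ⟨_, _, ?_, ?_, ?_, hst.mono hmono le_rfl,
    hV.joinedWithin_halfSpace (-g) ⟨q, hq, neg_lt_neg hqc⟩ hs' ht' (neg_le_neg (hg s' hs'))
      (neg_le_neg (hg t' ht'))⟩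
  · rw [Set.disjoint_left]
    rintro p ⟨⟨-, hpc⟩, hp⟩ (hp' | ⟨-, hp'⟩)
    · exact hp (.inr hp')
    · exact (neg_lt_neg_iff.1 hp').ne hpc
  · exact fun h => h.2 (by simp)
  · rintro ((h | h) | ⟨-, h⟩)
    · exact hxs' h
    · exact hxt' h
    · exact (neg_lt_neg_iff.1 h).ne hxF.2

variable [SeparatingDual ℝ E]

lemma InConvexPosition.linkedAvoiding_of_facet (hV : InConvexPosition V)
    (hdim : 4 ≤ Module.finrank ℝ (vectorSpan ℝ V)) (hF : IsFacet V F)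
    (hpath : HasAvoidingPath (edgeGraph F) F) (hnodup : [x, s, t, s', t'].Nodup)
    (hmem : {x, s, t, s', t'} ⊆ V) (hxst : {x, s, t} ⊆ F) :
    LinkedAvoiding (edgeGraph V) x s t s' t' := by
  have hFV : F ≠ V := by
    rintro rfl
    exact absurd hF.finrank_add_one (Nat.succ_ne_self _)
  have hFconv := hV.subset hF.isExposedSubset.subset
  have hx : x ∈ F := hxst (by simp)
  have hs : s ∈ F := hxst (by simp)
  have ht : t ∈ F := hxst (by simp)
  have hs' : s' ∈ V := hmem (by simp)
  have ht' : t' ∈ V := hmem (by simp)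
  have hlink := hV.linkedAvoiding_of_face (s := s) (t := t) hF.isExposedSubset hFV hx
    (by grind : x ≠ s') (by grind : x ≠ t') hs' ht'
  have havoid {y : E} (hsy : s ≠ y) (hty : t ≠ y) :
      JoinedWithin (edgeGraph F) (F \ {x, y}) s t := by
    refine hFconv.joinedWithin_diff (Set.toFinite _) ?_ ⟨hs, by grind⟩ ⟨ht, by grind⟩
    have htriple := (coplanar_triple ℝ s x y).finrank_le_two
    have := hF.finrank_add_one
    omega
  by_cases hs'F : s' ∈ F
  · by_cases ht'F : t' ∈ F
    · obtain hst | hst' := hpath x s t s' t' hnodup (by grind)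
      · exact hlink hst
      · exact (hV.linkedAvoiding_of_face hF.isExposedSubset hFV hx (by grind) (by grind)
          (hmem (by simp)) (hmem (by simp)) hst').swap
    · exact hlink ((havoid (y := s') (by grind) (by grind)).mono le_rfl (by grind))
  · exact hlink ((havoid (y := t') (by grind) (by grind)).mono le_rfl (by grind))

theorem InConvexPosition.linkedAvoiding (hV : InConvexPosition V)
    (hdim : 4 ≤ Module.finrank ℝ (vectorSpan ℝ V))
    (hpath : ∀ F, IsFacet V F → HasAvoidingPath (edgeGraph F) F)
    (hnodup : [x, s, t, s', t'].Nodup) (hmem : {x, s, t, s', t'} ⊆ V) :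
    LinkedAvoiding (edgeGraph V) x s t s' t' := by
  have htriple := (coplanar_triple ℝ x s t).finrank_le_two
  obtain ⟨f, a, hf, hs', ht', habove, hbelow⟩ | ⟨F, hF, hsub⟩ :=
    exists_hyperplane_or_isFacet (A := {x, s, t}) hV.finite (fun v hv => hmem (by grind))
      (Set.insert_nonempty _ _) (by omega) s' (hmem (by simp) : t' ∈ V)
  · exact hV.linkedAvoiding_of_hyperplane f habove hbelow hnodup hmem hf hs' ht'
  · exact hV.linkedAvoiding_of_facet hdim hF (hpath F hF) hnodup hmem hsub

end Linking

/-! ### The face lattice -/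

section FaceLattice

variable {m n : ℕ} {V : Set (EuclideanSpace ℝ (Fin m))} {W : Set (EuclideanSpace ℝ (Fin n))}

instance (P : Set (EuclideanSpace ℝ (Fin n))) : OrderBot (Face P) where
  bot := ⟨∅, fun h => (Set.not_nonempty_empty h).elim⟩
  bot_le F := Set.empty_subset F.1

/-- The face of `convexHull ℝ V` that consists of a single point of `V`. -/
def InConvexPosition.vertexFace (hV : InConvexPosition V) (v : V) : Face (convexHull ℝ V) :=
  ⟨{v.1}, mem_exposedPoints_iff_exposed_singleton.1 (hV.exposedPoints_convexHull.ge v.2)⟩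

lemma InConvexPosition.isAtom_iff (hV : InConvexPosition V) {F : Face (convexHull ℝ V)} :
    IsAtom F ↔ ∃ v, hV.vertexFace v = F := by
  constructor
  · intro hF
    obtain ⟨T, hT, hFT⟩ := CubicalPolytope.isExposed_convexHull_iff.1 F.2
    obtain ⟨v, hv⟩ : T.Nonempty := by
      by_contra hempty
      rw [Set.not_nonempty_iff_eq_empty.1 hempty, convexHull_empty] at hFT
      exact hF.1 (Subtype.ext hFT)
    have hle : hV.vertexFace ⟨v, hT.subset hv⟩ ≤ F :=
      Set.singleton_subset_iff.2 (hFT ▸ subset_convexHull ℝ T hv)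
    refine ⟨_, (hF.le_iff.1 hle).resolve_left fun h => ?_⟩
    exact Set.singleton_ne_empty v (congrArg Subtype.val h)
  · rintro ⟨v, rfl⟩
    refine ⟨fun h => Set.singleton_ne_empty v.1 (congrArg Subtype.val h), fun G hG => ?_⟩
    exact Subtype.ext (Set.ssubset_singleton_iff.1 hG)

/-- The points of `V` correspond to the atoms of the face lattice of `convexHull ℝ V`. -/
noncomputable def InConvexPosition.equivAtoms (hV : InConvexPosition V) :
    V ≃ {F : Face (convexHull ℝ V) // IsAtom F} :=
  Equiv.ofBijective (fun v => ⟨hV.vertexFace v, hV.isAtom_iff.2 ⟨v, rfl⟩⟩)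
    ⟨fun _ _ h => Subtype.ext (Set.singleton_injective (congrArg (fun F => F.1.1) h)),
      fun F => (hV.isAtom_iff.1 F.2).imp fun _ h => Subtype.ext h⟩

lemma CombEquiv.exists_equiv (hV : InConvexPosition V) (hW : InConvexPosition W)
    (h : CombEquiv (convexHull ℝ V) (convexHull ℝ W)) :
    ∃ e : V ≃ W, ∀ U, IsExposedSubset V U →
      ∃ U', IsExposedSubset W U' ∧ ∀ v, (e v).1 ∈ U' ↔ v.1 ∈ U := by
  obtain ⟨φ⟩ := h
  set e : V ≃ W := hV.equivAtoms.trans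
    ((φ.toEquiv.subtypeEquiv fun F => (φ.isAtom_iff F).symm).trans hW.equivAtoms.symm)
  have he : ∀ v, hW.vertexFace (e v) = φ (hV.vertexFace v) := fun v =>
    congrArg Subtype.val (hW.equivAtoms.apply_symm_apply _)
  refine ⟨e, fun U hU => ?_⟩
  set F : Face (convexHull ℝ V) := ⟨_, isExposed_convexHull_iff.2 ⟨U, hU, rfl⟩⟩
  obtain ⟨U', hU', hFU'⟩ := CubicalPolytope.isExposed_convexHull_iff.1 (φ F).2
  refine ⟨U', hU', fun v => ?_⟩
  calc (e v).1 ∈ U' ↔ (e v).1 ∈ convexHull ℝ U' :=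
        ⟨fun h => subset_convexHull ℝ U' h, hW.mem_of_mem_convexHull hU'.subset (e v).2⟩
    _ ↔ hW.vertexFace (e v) ≤ φ F := by
        rw [← hFU', ← Subtype.coe_le_coe]
        exact Set.singleton_subset_iff.symm
    _ ↔ hV.vertexFace v ≤ F := by rw [he, φ.le_iff_le]
    _ ↔ v.1 ∈ convexHull ℝ U := Set.singleton_subset_iff
    _ ↔ v.1 ∈ U := ⟨hV.mem_of_mem_convexHull hU.subset v.2, fun h => subset_convexHull ℝ U h⟩

end FaceLattice

/-! ### The cube -/

section Cube

variable {d : ℕ}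

/-- The vertex of `stdCube d` with coordinates `0` and `1` given by the truth values of `σ`. -/
def cubeVertex (σ : Fin d → Bool) : EuclideanSpace ℝ (Fin d) :=
  WithLp.toLp 2 fun j => if σ j then 1 else 0

lemma cubeVertex_injective : Function.Injective (cubeVertex (d := d)) := by
  intro σ τ h
  funext j
  have hj : (if σ j then (1 : ℝ) else 0) = if τ j then 1 else 0 :=
    congrFun (WithLp.toLp_injective 2 h) j
  cases hσ : σ j <;> cases hτ : τ j <;> simp [hσ, hτ] at hj ⊢

lemma convexHull_range_cubeVertex :
    convexHull ℝ (Set.range cubeVertex) = stdCube d := by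
  have hrange : Set.range cubeVertex = (WithLp.linearEquiv 2 ℝ (Fin d → ℝ)).symm ''
      Set.univ.pi fun _ => ({0, 1} : Set ℝ) := by
    ext x
    constructor
    · rintro ⟨σ, rfl⟩
      exact ⟨fun j => if σ j then 1 else 0, fun j _ => by cases σ j <;> simp, rfl⟩
    · rintro ⟨y, hy, rfl⟩
      refine ⟨fun j => decide (y j = 1), ?_⟩
      ext j
      have hj : y j = 0 ∨ y j = 1 := hy j trivial
      rcases hj with h | h <;> simp [cubeVertex, h]
  rw [hrange, ← LinearEquiv.coe_toLinearMap, ← LinearMap.image_convexHull, convexHull_pi]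
  simp only [convexHull_pair, segment_eq_Icc zero_le_one]
  ext x
  exact ⟨by rintro ⟨y, hy, rfl⟩ i; exact hy i trivial, fun hx => ⟨x.ofLp, fun i _ => hx i, rfl⟩⟩

/-- The functional counts, with signs, the coordinates in `K` in which a vertex agrees with `σ`. -/
lemma isExposedSubset_range_cubeVertex (σ : Fin d → Bool) (K : Finset (Fin d)) :
    IsExposedSubset (Set.range cubeVertex) (cubeVertex '' {τ | ∀ j ∈ K, τ j = σ j}) := by
  set l : EuclideanSpace ℝ (Fin d) →L[ℝ] ℝ :=
    ∑ j ∈ K, (if σ j then (1 : ℝ) else -1) • EuclideanSpace.proj j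
  set c : ℝ := ∑ j ∈ K, if σ j then (1 : ℝ) else 0
  have hl : ∀ τ, l (cubeVertex τ) =
      ∑ j ∈ K, (if σ j then (1 : ℝ) else -1) * if τ j then 1 else 0 := fun τ => by
    simp only [l, sum_apply, smul_apply, smul_eq_mul]
    rfl
  have hle : ∀ τ : Fin d → Bool, ∀ j ∈ K, ((if σ j then (1 : ℝ) else -1) * if τ j then 1 else 0) ≤
      if σ j then (1 : ℝ) else 0 := fun τ j _ => by
    cases σ j <;> cases τ j <;> simp
  refine ⟨l, c, ?_, ?_⟩
  · rintro _ ⟨τ, rfl⟩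
    exact (hl τ).trans_le (Finset.sum_le_sum (hle τ))
  · have heq : ∀ τ, l (cubeVertex τ) = c ↔ ∀ j ∈ K, τ j = σ j := fun τ => by
      rw [hl, Finset.sum_eq_sum_iff_of_le (hle τ)]
      refine forall₂_congr fun j _ => ?_
      cases σ j <;> cases τ j <;> simp
    ext x
    constructor
    · rintro ⟨τ, hτ, rfl⟩
      exact ⟨⟨τ, rfl⟩, (heq τ).2 hτ⟩
    · rintro ⟨⟨τ, rfl⟩, hτ⟩
      exact ⟨τ, (heq τ).1 hτ, rfl⟩

lemma inConvexPosition_range_cubeVertex :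
    InConvexPosition (Set.range (cubeVertex (d := d))) where
  finite := Set.finite_range _
  isExposedSubset_singleton := by
    rintro _ ⟨σ, rfl⟩
    convert isExposedSubset_range_cubeVertex σ Finset.univ
    simp [← funext_iff]

/-- The graph of the `d`-cube: two vertices are adjacent when they differ in one coordinate. -/
def cubeGraph (d : ℕ) : SimpleGraph (Fin d → Bool) where
  Adj σ τ := hammingDist σ τ = 1
  symm := ⟨fun σ τ h => (hammingDist_comm τ σ).trans h⟩
  loopless := ⟨fun σ h => by simp at h⟩

lemma isExposedSubset_of_cubeGraph_adj {σ τ : Fin d → Bool} (h : (cubeGraph d).Adj σ τ) :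
    IsExposedSubset (Set.range cubeVertex) {cubeVertex σ, cubeVertex τ} := by
  obtain ⟨j, hj⟩ := Finset.card_eq_one.1 h
  have hne : ∀ i, σ i ≠ τ i ↔ i = j := fun i => by
    simpa using congrArg (i ∈ ·) hj
  convert isExposedSubset_range_cubeVertex σ (Finset.univ.erase j)
  rw [← Set.image_pair]
  congr 1
  ext ρ
  constructor
  · rintro (rfl | rfl) i hi
    · rfl
    · exact (not_not.1 (mt (hne i).1 (Finset.ne_of_mem_erase hi))).symm
  · intro hρ
    have hρ' : ∀ i ≠ j, ρ i = σ i := fun i hi => hρ i (by simpa using hi)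
    by_cases hρj : ρ j = σ j
    · exact Or.inl (funext fun i => (eq_or_ne i j).elim (fun h => h ▸ hρj) (hρ' i))
    · refine Or.inr (funext fun i => ?_)
      obtain rfl | hi := eq_or_ne i j
      · exact (Bool.eq_not_iff.2 hρj).trans (Bool.eq_not_iff.2 ((hne i).2 rfl).symm).symm
      · exact (hρ' i hi).trans (not_not.1 (mt (hne i).1 hi))

lemma CombEquiv.exists_cubeGraph_hom {n : ℕ} {V : Set (EuclideanSpace ℝ (Fin n))}
    (hV : InConvexPosition V) (h : CombEquiv (convexHull ℝ V) (stdCube d)) :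
    ∃ φ : cubeGraph d →g edgeGraph V, Function.Injective φ ∧ Set.range φ = V := by
  rw [← convexHull_range_cubeVertex] at h
  obtain ⟨e, he⟩ := CombEquiv.exists_equiv inConvexPosition_range_cubeVertex hV
    (h.map OrderIso.symm)
  set φ : (Fin d → Bool) → EuclideanSpace ℝ (Fin n) := fun σ => (e ⟨_, σ, rfl⟩).1
  have hφ : Function.Injective φ := fun σ τ h =>
    cubeVertex_injective (congrArg Subtype.val (e.injective (Subtype.ext h)))
  have hrange : Set.range φ = V := by
    ext v
    constructor
    · rintro ⟨σ, rfl⟩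
      exact (e _).2
    · intro hv
      obtain ⟨⟨-, σ, rfl⟩, hσ⟩ := e.surjective ⟨v, hv⟩
      exact ⟨σ, congrArg Subtype.val hσ⟩
  refine ⟨⟨φ, @fun σ τ hστ => ⟨hφ.ne hστ.ne, ?_⟩⟩, hφ, hrange⟩
  obtain ⟨U, hU, hmem⟩ := he _ (isExposedSubset_of_cubeGraph_adj hστ)
  suffices U = {φ σ, φ τ} from this ▸ hU
  have hφU : ∀ ρ, φ ρ ∈ U ↔ ρ = σ ∨ ρ = τ := fun ρ => (hmem ⟨_, ρ, rfl⟩).trans <| by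
    simp [cubeVertex_injective.eq_iff]
  apply Set.Subset.antisymm
  · intro v hv
    obtain ⟨ρ, rfl⟩ := hrange.ge (hU.subset hv)
    simpa [hφ.eq_iff] using (hφU ρ).1 hv
  · rintro _ (rfl | rfl)
    · exact (hφU σ).2 (Or.inl rfl)
    · exact (hφU τ).2 (Or.inr rfl)

end Cube

section CubeSearch

variable {d : ℕ}

/-- Searches the graph of the `d`-cube for a path of length at most `n` from `σ` to `τ` which
avoids `Z` after its first vertex. -/
def cubeReach (Z : List (Fin d → Bool)) : ℕ → (Fin d → Bool) → (Fin d → Bool) → Bool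
  | 0, σ, τ => σ == τ
  | n + 1, σ, τ => σ == τ || (List.finRange d).any fun j =>
      !Z.contains (Function.update σ j (!σ j)) && cubeReach Z n (Function.update σ j (!σ j)) τ

lemma cubeGraph_adj_update (σ : Fin d → Bool) (j : Fin d) :
    (cubeGraph d).Adj σ (Function.update σ j (!σ j)) := by
  refine Finset.card_eq_one.2 ⟨j, ?_⟩
  ext i
  by_cases hij : i = j <;> simp [hij]

lemma joinedWithin_of_cubeReach {Z : List (Fin d → Bool)} {n : ℕ} {σ τ : Fin d → Bool}
    (hσ : σ ∉ Z) (h : cubeReach Z n σ τ = true) : JoinedWithin (cubeGraph d) {ρ | ρ ∉ Z} σ τ := by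
  induction n generalizing σ with
  | zero => exact beq_iff_eq.1 h ▸ .refl hσ
  | succ n ih =>
    rw [cubeReach, Bool.or_eq_true, List.any_eq_true] at h
    obtain h | ⟨j, -, h⟩ := h
    · exact beq_iff_eq.1 h ▸ .refl hσ
    · simp only [Bool.and_eq_true, Bool.not_eq_true', List.contains_eq_mem,
        decide_eq_false_iff_not] at h
      exact (JoinedWithin.of_adj (cubeGraph_adj_update σ j) hσ h.1).trans (ih h.1 h.2)

lemma cubeReach_or_cubeReach : ∀ s t s' t' : Fin 3 → Bool,
    [fun _ => false, s, t, s', t'].Nodup →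
      cubeReach [fun _ => false, s', t'] 4 s t ∨ cubeReach [fun _ => false, s, t] 4 s' t' := by
  decide +kernel

/-- The automorphism of the graph of the `d`-cube that reflects the coordinates in which `ρ` is
true. It is an involution which maps `ρ` to the origin. -/
def cubeReflection (ρ : Fin d → Bool) : cubeGraph d →g cubeGraph d where
  toFun σ j := xor (σ j) (ρ j)
  map_rel' h := (hammingDist_comp (fun j b => xor b (ρ j)) fun _ _ _ => Bool.xor_left_inj.1).trans h

lemma cubeReflection_involutive (ρ : Fin d → Bool) : Function.Involutive (cubeReflection ρ) :=
  fun σ => funext fun j => (Bool.xor_assoc _ _ _).trans (by rw [Bool.xor_self, Bool.xor_false])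

lemma cubeReflection_self (ρ : Fin d → Bool) : cubeReflection ρ ρ = fun _ => false :=
  funext fun j => Bool.xor_self (ρ j)

lemma hasAvoidingPath_cubeGraph : HasAvoidingPath (cubeGraph 3) Set.univ := by
  intro x s t s' t' hnodup _
  set ψ := cubeReflection x
  have hψ : Function.Involutive ψ := cubeReflection_involutive x
  have hψx : ψ x = fun _ => false := cubeReflection_self x
  have hpath : ∀ {y z a b}, a ∉ [x, y, z] → cubeReach [ψ x, ψ y, ψ z] 4 (ψ a) (ψ b) = true →
      JoinedWithin (cubeGraph 3) (Set.univ \ {x, y, z}) a b := by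
    intro y z a b ha hreach
    have hjoin := joinedWithin_of_cubeReach (Z := [x, y, z].map ψ)
      (by rwa [List.mem_map_of_injective hψ.injective]) hreach
    rw [← hψ a, ← hψ b]
    refine .map ψ (S := Set.univ \ {x, y, z}) (hjoin.mono le_rfl fun ρ hρ => ⟨trivial, ?_⟩)
    refine fun hψρ => hρ ?_
    rw [← hψ ρ]
    exact List.mem_map_of_mem (by simpa using hψρ)
  have hnodup' : [ψ x, ψ s, ψ t, ψ s', ψ t'].Nodup := hnodup.map hψ.injective
  rw [hψx] at hnodup' hpath
  exact (cubeReach_or_cubeReach _ _ _ _ hnodup').imp (hpath (by grind)) (hpath (by grind))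

lemma CombEquiv.hasAvoidingPath_edgeGraph {n : ℕ} {V : Set (EuclideanSpace ℝ (Fin n))}
    (hV : InConvexPosition V) (h : CombEquiv (convexHull ℝ V) (stdCube 3)) :
    HasAvoidingPath (edgeGraph V) V := by
  obtain ⟨φ, hφ, hrange⟩ := h.exists_cubeGraph_hom hV
  have := hasAvoidingPath_cubeGraph.map φ hφ
  rwa [Set.image_univ, hrange] at this

end CubeSearch

/-! ### Strong linkedness -/

lemma injective_sumElim_fin_two {α : Type*} {s t : Fin 2 → α} :
    Function.Injective (Sum.elim s t) ↔ [s 0, t 0, s 1, t 1].Nodup := by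
  simp only [Function.Injective.eq_1, Sum.forall, Fin.forall_fin_two]
  grind

section StronglyLinked

variable {n : ℕ} {P V : Set (EuclideanSpace ℝ (Fin n))}

lemma isStronglyLinked_iff : IsStronglyLinked 4 2 P ↔ 5 ≤ (vertexSet P).encard ∧
    ∀ x s t s' t', [x, s, t, s', t'].Nodup → LinkedAvoiding (polytopeGraph P) x s t s' t' := by
  classical
  refine and_congr_right fun _ => ⟨fun h x s t s' t' hnodup => ?_, fun h X hX s t hinj hs ht => ?_⟩
  · obtain ⟨L, hdisj, havoid⟩ := h [x, s, t, s', t'].toFinset (List.toFinset_card_of_nodup hnodup)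
      ![s, s'] ![t, t'] (injective_sumElim_fin_two.2 hnodup.of_cons)
      (by simp [Fin.forall_fin_two]) (by simp [Fin.forall_fin_two])
    have hx := havoid x (by simp) (by simp_all [Fin.forall_fin_two])
    exact ⟨{v | v ∈ (L 0).1.support}, {v | v ∈ (L 1).1.support},
      Set.disjoint_left.2 (hdisj 0 1 zero_ne_one), hx 0, hx 1, ⟨(L 0).1, fun _ => id⟩,
      ⟨(L 1).1, fun _ => id⟩⟩
  · set Y := Finset.univ.image (Sum.elim s t)
    have hYX : Y ⊆ X := Finset.image_subset_iff.2 fun i _ => by cases i <;> simp [hs, ht]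
    have hY : Y.card = 4 := Finset.card_image_of_injective _ hinj
    obtain ⟨x, hx⟩ := Finset.card_eq_one.1 (by rw [Finset.card_sdiff_of_subset hYX, hX, hY])
    have hxY : x ∉ Y := (Finset.mem_sdiff.1 (hx.ge (Finset.mem_singleton_self x))).2
    have hxst : x ∉ [s 0, t 0, s 1, t 1] := by
      simp only [Y, Finset.mem_image, Finset.mem_univ, true_and, Sum.exists, Fin.exists_fin_two,
        Sum.elim_inl, Sum.elim_inr] at hxY
      grind
    have hnodup := List.nodup_cons.2 ⟨hxst, injective_sumElim_fin_two.1 hinj⟩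
    obtain ⟨S, S', hdisj, hxS, hxS', ⟨p, hp⟩, p', hp'⟩ := h _ _ _ _ _ hnodup
    have hpath : ∀ z ∈ p.toPath.1.support, z ∈ S := fun z hz =>
      hp z (p.support_toPath_subset_support hz)
    have hpath' : ∀ z ∈ p'.toPath.1.support, z ∈ S' := fun z hz =>
      hp' z (p'.support_toPath_subset_support hz)
    refine ⟨Fin.cons p.toPath (Fin.cons p'.toPath finZeroElim), ?_, fun y hy hyst => ?_⟩
    · rw [Fin.forall_fin_two, Fin.forall_fin_two, Fin.forall_fin_two]
      exact ⟨⟨fun h => absurd rfl h, fun _ v hv hv' =>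
          Set.disjoint_left.1 hdisj (hpath v hv) (hpath' v hv')⟩,
        fun _ v hv hv' => Set.disjoint_left.1 hdisj (hpath v hv') (hpath' v hv),
        fun h => absurd rfl h⟩
    · obtain rfl : y = x := Finset.mem_singleton.1 <| hx.le <| Finset.mem_sdiff.2 ⟨hy, by
        simpa [Y, Fin.forall_fin_two, eq_comm, and_and_and_comm] using hyst⟩
      rw [Fin.forall_fin_two]
      exact ⟨fun h => hxS (hpath y h), fun h => hxS' (hpath' y h)⟩

lemma InConvexPosition.polytopeGraph_convexHull (hV : InConvexPosition V) :
    polytopeGraph (convexHull ℝ V) = (edgeGraph V).induce (vertexSet (convexHull ℝ V)) := by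
  ext u v
  have huv : {u.1, v.1} ⊆ V :=
    Set.pair_subset (hV.exposedPoints_convexHull.le u.2) (hV.exposedPoints_convexHull.le v.2)
  change (u ≠ v ∧ _) ↔ (u.1 ≠ v.1 ∧ _)
  rw [← convexHull_pair, hV.isExposed_convexHull_iff huv, Ne, Subtype.ext_iff]
  rfl

lemma vectorSpan_convexHull {E : Type*} [AddCommGroup E] [Module ℝ E] (S : Set E) :
    vectorSpan ℝ (convexHull ℝ S) = vectorSpan ℝ S := by
  rw [← direction_affineSpan, affineSpan_convexHull, direction_affineSpan]

lemma hasDim_convexHull_iff {d : ℕ} :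
    HasDim d (convexHull ℝ V) ↔ V.Nonempty ∧ Module.finrank ℝ (vectorSpan ℝ V) = d := by
  rw [HasDim, convexHull_nonempty_iff, vectorSpan_convexHull]

lemma isDPolytope_convexHull_iff {d : ℕ} (hV : V.Finite) :
    IsDPolytope d (convexHull ℝ V) ↔ V.Nonempty ∧ Module.finrank ℝ (vectorSpan ℝ V) = d :=
  (and_iff_right ⟨hV.toFinset, by rw [hV.coe_toFinset]⟩).trans hasDim_convexHull_iff

lemma finrank_vectorSpan_add_one_le_encard {k E : Type*} [DivisionRing k] [AddCommGroup E]
    [Module k E] {S : Set E} (hS : S.Nonempty) :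
    (Module.finrank k (vectorSpan k S) + 1 : ℕ) ≤ S.encard := by
  obtain hfin | hinf := S.finite_or_infinite
  · have := hfin.fintype
    have := hS.to_subtype
    have := finrank_vectorSpan_range_add_one_le k ((↑) : S → E)
    rw [Subtype.range_coe, Fintype.card_eq_nat_card, Nat.card_coe_set_eq] at this
    rw [← hfin.cast_ncard_eq]
    exact_mod_cast this
  · simp [hinf.encard_eq]

lemma IsPolytope.exists_inConvexPosition (h : IsPolytope P) :
    ∃ V, InConvexPosition V ∧ P = convexHull ℝ V := by
  obtain ⟨S, rfl⟩ := h
  obtain ⟨V, hV, heq⟩ := CubicalPolytope.exists_inConvexPosition S.finite_toSet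
  exact ⟨V, hV, heq.symm⟩

theorem IsCubicalDPolytope.isStronglyLinked (hP : IsCubicalDPolytope 4 P) :
    IsStronglyLinked 4 2 P := by
  obtain ⟨⟨hpoly, hdim⟩, hcubical⟩ := hP
  obtain ⟨V, hV, rfl⟩ := hpoly.exists_inConvexPosition
  obtain ⟨hne, hdim⟩ := hasDim_convexHull_iff.1 hdim
  have hpath : ∀ F, IsFacet V F → HasAvoidingPath (edgeGraph F) F := fun F hF => by
    have hexposed := isExposed_convexHull_iff.2 ⟨F, hF.isExposedSubset, rfl⟩
    have hdimF : HasDim 3 (convexHull ℝ F) :=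
      hasDim_convexHull_iff.2 ⟨hF.nonempty, by linarith [hF.finrank_add_one]⟩
    exact (hcubical _ hexposed 3 rfl hdimF).hasAvoidingPath_edgeGraph
      (hV.subset hF.isExposedSubset.subset)
  refine isStronglyLinked_iff.2 ⟨?_, fun x s t s' t' hnodup => ?_⟩
  · rw [vertexSet, hV.exposedPoints_convexHull]
    simpa [hdim] using finrank_vectorSpan_add_one_le_encard (k := ℝ) hne
  · rw [hV.polytopeGraph_convexHull]
    refine LinkedAvoiding.induce (fun u v huv => ?_) ?_
    · exact hV.exposedPoints_convexHull.ge (edgeGraph_adj_mem huv.symm)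
    · refine hV.linkedAvoiding hdim.ge hpath (hnodup.map Subtype.val_injective) ?_
      simp only [Set.insert_subset_iff, Set.singleton_subset_iff]
      have := fun v : vertexSet (convexHull ℝ V) => hV.exposedPoints_convexHull.le v.2
      exact ⟨this x, this s, this t, this s', this t'⟩

end StronglyLinked

/-! ### Two-fold pyramids over quadrangles -/

section Insert

variable {E : Type*} [AddCommGroup E] [Module ℝ E] [TopologicalSpace E] [SeparatingDual ℝ E]
  {V : Set E} {a : E}

lemma InConvexPosition.insert (hV : InConvexPosition V) (ha : a ∉ affineSpan ℝ V) :
    InConvexPosition (insert a V) where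
  finite := hV.finite.insert a
  isExposedSubset_singleton v hv := by
    have := finiteDimensional_vectorSpan_of_finite ℝ hV.finite
    obtain ⟨k, d, hk, hka⟩ := exists_functional_of_notMem_affineSpan ha
    obtain rfl | hvV := hv
    · refine ⟨k, k v, ?_, ?_⟩
      · exact Set.forall_mem_insert.2 ⟨le_rfl, fun w hw => (hk w hw).trans_le hka.le⟩
      · refine Set.Subset.antisymm (by simp) ?_
        rintro w ⟨rfl | hw, hwv⟩
        · rfl
        · exact absurd (hk w hw) (hwv.trans_ne hka.ne')
    · obtain ⟨l, c, hl, heq⟩ := hV.isExposedSubset_singleton v hvV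
      -- Subtracting a large multiple of `k`, constant on `V`, from `l` makes `a` irrelevant.
      obtain ⟨r, hr⟩ := exists_gt ((l a - c) / (k a - d))
      rw [div_lt_iff₀ (sub_pos.2 hka)] at hr
      refine ⟨l - r • k, c - r * d, ?_, ?_⟩
      · refine Set.forall_mem_insert.2 ⟨?_, fun w hw => ?_⟩
        · simp only [sub_apply, smul_apply, smul_eq_mul]
          linarith
        · simpa [hk w hw] using hl w hw
      · rw [heq]
        ext w
        constructor
        · rintro ⟨hw, hwc⟩
          exact ⟨Or.inr hw, by simp [hwc, hk w hw]⟩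
        · rintro ⟨rfl | hw, hwc⟩
          · simp only [sub_apply, smul_apply, smul_eq_mul] at hwc
            linarith
          · exact ⟨hw, by simpa [hk w hw] using hwc⟩

end Insert

section Crossing

variable {n : ℕ} {P Q R V : Set (EuclideanSpace ℝ (Fin n))}

lemma InConvexPosition.isQuadrangle_convexHull_iff (hV : InConvexPosition V) :
    IsQuadrangle (convexHull ℝ V) ↔ Module.finrank ℝ (vectorSpan ℝ V) = 2 ∧ V.encard = 4 := by
  rw [IsQuadrangle, isDPolytope_convexHull_iff hV.finite, vertexSet, hV.exposedPoints_convexHull]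
  refine ⟨fun h => ⟨h.1.2, h.2⟩, fun h => ⟨⟨?_, h.1⟩, h.2⟩⟩
  exact Set.encard_ne_zero.1 (by simp [h.2])

/-- Radon's theorem: each of the two parts of a Radon partition of the vertices has two points. -/
lemma InConvexPosition.exists_crossing_diagonals (hV : InConvexPosition V)
    (hdim : Module.finrank ℝ (vectorSpan ℝ V) = 2) (hcard : V.encard = 4) :
    ∃ s t s' t', [s, t, s', t'].Nodup ∧ V = {s, t, s', t'} ∧
      (segment ℝ s t ∩ segment ℝ s' t').Nonempty := by
  have := hV.finite.fintype
  have hncard : V.ncard = 4 := by simp [Set.ncard, hcard]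
  have hindep : ¬ AffineIndependent ℝ ((↑) : V → EuclideanSpace ℝ (Fin n)) := by
    rw [affineIndependent_iff_finrank_vectorSpan_eq ℝ _ (n := 3)
      (by rw [Fintype.card_eq_nat_card, Nat.card_coe_set_eq, hncard]), Subtype.range_coe, hdim]
    norm_num
  obtain ⟨I, hcross⟩ := Convex.radon_partition hindep
  set A : Set (EuclideanSpace ℝ (Fin n)) := (↑) '' I
  set B : Set (EuclideanSpace ℝ (Fin n)) := (↑) '' Iᶜ
  have hAV : A ⊆ V := Subtype.coe_image_subset V I
  have hBV : B ⊆ V := Subtype.coe_image_subset V Iᶜ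
  have hAB : Disjoint A B :=
    (Set.disjoint_image_iff Subtype.val_injective).2 disjoint_compl_right
  have hunion : A ∪ B = V := by
    rw [← Set.image_union, Set.union_compl_self, Set.image_univ, Subtype.range_coe]
  have hA := (Set.one_lt_ncard (hV.finite.subset hAV)).2
    (hV.nontrivial_of_convexHull_inter hAV hBV hAB hcross)
  have hB := (Set.one_lt_ncard (hV.finite.subset hBV)).2
    (hV.nontrivial_of_convexHull_inter hBV hAV hAB.symm (Set.inter_comm _ _ ▸ hcross))
  have hsum := Set.ncard_union_eq hAB (hV.finite.subset hAV) (hV.finite.subset hBV)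
  rw [hunion, hncard] at hsum
  obtain ⟨s, t, hst, hAst⟩ := Set.ncard_eq_two.1 (show A.ncard = 2 by omega)
  obtain ⟨s', t', hst', hBst⟩ := Set.ncard_eq_two.1 (show B.ncard = 2 by omega)
  rw [hAst, hBst] at hAB hcross hunion
  rw [convexHull_pair, convexHull_pair] at hcross
  refine ⟨s, t, s', t', ?_, ?_, hcross⟩
  · simp only [Set.disjoint_insert_left, Set.disjoint_singleton_left, Set.mem_insert_iff,
      Set.mem_singleton_iff] at hAB
    simp [hst, hst', hAB]
  · rw [← hunion, Set.insert_union, Set.singleton_union]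

lemma InConvexPosition.not_isStronglyLinked_convexHull (hV : InConvexPosition V)
    {a b s t s' t' : EuclideanSpace ℝ (Fin n)} (heq : V = {b, a, s, t, s', t'})
    (hnodup : [a, s, t, s', t'].Nodup) (hcross : (segment ℝ s t ∩ segment ℝ s' t').Nonempty) :
    ¬ IsStronglyLinked 4 2 (convexHull ℝ V) := by
  rw [isStronglyLinked_iff, hV.polytopeGraph_convexHull]
  rintro ⟨-, hlinked⟩
  have hvertex := hV.exposedPoints_convexHull
  have hdisj : Disjoint ({s, t} : Set (EuclideanSpace ℝ (Fin n))) {s', t'} := by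
    simp only [Set.disjoint_insert_left, Set.disjoint_singleton_left]
    grind
  simp only [← convexHull_pair, ← Set.not_disjoint_iff_nonempty_inter] at hcross
  have hst : ¬ IsExposedSubset V {s, t} := fun h =>
    hcross (h.disjoint_convexHull (by simp [heq, Set.pair_subset_iff]) hdisj)
  have hst' : ¬ IsExposedSubset V {s', t'} := fun h =>
    hcross (h.disjoint_convexHull (by simp [heq, Set.pair_subset_iff]) hdisj.symm).symm
  have hmem : ∀ v ∈ V, v ∈ vertexSet (convexHull ℝ V) := hvertex.ge
  lift a to vertexSet (convexHull ℝ V) using hmem _ (by simp [heq])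
  lift b to vertexSet (convexHull ℝ V) using hmem _ (by simp [heq])
  lift s to vertexSet (convexHull ℝ V) using hmem _ (by simp [heq])
  lift t to vertexSet (convexHull ℝ V) using hmem _ (by simp [heq])
  lift s' to vertexSet (convexHull ℝ V) using hmem _ (by simp [heq])
  lift t' to vertexSet (convexHull ℝ V) using hmem _ (by simp [heq])
  replace hnodup : [a, s, t, s', t'].Nodup := List.Nodup.of_map Subtype.val hnodup
  refine absurd (hlinked a s t s' t' hnodup) <| not_linkedAvoiding_of_not_adj (b := b)
    (fun z => ?_) (by grind) (by grind) (fun h => hst h.2) (fun h => hst' h.2)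
  have hz : z.1 ∈ V := hvertex.le z.2
  simp only [heq, Set.mem_insert_iff, Set.mem_singleton_iff, ← Subtype.ext_iff] at hz
  tauto

lemma convexHull_insert_convexHull {E : Type*} [AddCommGroup E] [Module ℝ E] (a : E) (S : Set E) :
    convexHull ℝ (insert a (convexHull ℝ S)) = convexHull ℝ (insert a S) := by
  rw [Set.insert_eq, convexHull_convexHull_union_right, ← Set.insert_eq]

lemma IsPyramid.exists_insert (hR : IsPyramid R (convexHull ℝ V)) (hV : InConvexPosition V)
    (hne : V.Nonempty) : ∃ a ∉ V, R = convexHull ℝ (insert a V) ∧ InConvexPosition (insert a V) ∧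
      Module.finrank ℝ (vectorSpan ℝ (insert a V)) = Module.finrank ℝ (vectorSpan ℝ V) + 1 := by
  obtain ⟨a, ha, rfl⟩ := hR
  rw [affineSpan_convexHull] at ha
  exact ⟨a, fun h => ha (mem_affineSpan ℝ h), convexHull_insert_convexHull a V, hV.insert ha,
    finrank_vectorSpan_insert_of_notMem hne ha⟩

theorem IsTwoFoldPyramid.not_isStronglyLinked (hP : IsTwoFoldPyramid P Q) (hQ : IsQuadrangle Q) :
    IsDPolytope 4 P ∧ (vertexSet P).encard = 6 ∧ ¬ IsStronglyLinked 4 2 P := by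
  obtain ⟨V, hV, rfl⟩ := hQ.1.1.exists_inConvexPosition
  obtain ⟨hdim, hcard⟩ := hV.isQuadrangle_convexHull_iff.1 hQ
  obtain ⟨R, hR, hP⟩ := hP
  obtain ⟨a, haV, rfl, hV', hdim'⟩ := hR.exists_insert hV (convexHull_nonempty_iff.1 hQ.1.2.1)
  obtain ⟨b, hbV, rfl, hW, hdimW⟩ := hP.exists_insert hV' (Set.insert_nonempty a V)
  refine ⟨(isDPolytope_convexHull_iff hW.finite).2 ⟨Set.insert_nonempty _ _, ?_⟩, ?_, ?_⟩
  · rw [hdimW, hdim', hdim]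
  · rw [vertexSet, hW.exposedPoints_convexHull, Set.encard_insert_of_notMem hbV,
      Set.encard_insert_of_notMem haV, hcard]
    norm_num
  · obtain ⟨s, t, s', t', hnodup, rfl, hcross⟩ := hV.exists_crossing_diagonals hdim hcard
    exact hW.not_isStronglyLinked_convexHull rfl (List.nodup_cons.2 ⟨by simpa using haV, hnodup⟩)
      hcross

end Crossing

section Existence

variable {n : ℕ} {Q : Set (EuclideanSpace ℝ (Fin n))}

lemma exists_isPyramid (hQ : Module.finrank ℝ (vectorSpan ℝ Q) < n) : ∃ P, IsPyramid P Q := by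
  have hspan : affineSpan ℝ Q ≠ ⊤ := fun h => by
    rw [← direction_affineSpan, h, AffineSubspace.direction_top, finrank_top,
      finrank_euclideanSpace_fin] at hQ
    exact hQ.false
  obtain ⟨a, ha⟩ := SetLike.exists_not_mem_of_ne_top _ hspan
  exact ⟨_, a, ha, rfl⟩

lemma IsPyramid.finrank_vectorSpan_le {P : Set (EuclideanSpace ℝ (Fin n))} (h : IsPyramid P Q) :
    Module.finrank ℝ (vectorSpan ℝ P) ≤ Module.finrank ℝ (vectorSpan ℝ Q) + 1 := by
  obtain ⟨a, -, rfl⟩ := h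
  rw [vectorSpan_convexHull]
  exact finrank_vectorSpan_insert_le_set ℝ Q a

lemma exists_isTwoFoldPyramid (hQ : Module.finrank ℝ (vectorSpan ℝ Q) + 1 < n) :
    ∃ P, IsTwoFoldPyramid P Q := by
  obtain ⟨R, hR⟩ := exists_isPyramid (Q := Q) (by omega)
  obtain ⟨P, hP⟩ := exists_isPyramid (hR.finrank_vectorSpan_le.trans_lt hQ)
  exact ⟨P, R, hR, hP⟩

/-- The vertices of a `2`-dimensional face of the `4`-cube. -/
def squareVertices : Set (EuclideanSpace ℝ (Fin 4)) :=
  {!₂[1, 1, 0, 0], !₂[0, 1, 0, 0], !₂[1, 0, 0, 0], !₂[0, 0, 0, 0]}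

lemma inConvexPosition_squareVertices : InConvexPosition squareVertices := by
  refine inConvexPosition_range_cubeVertex.subset ?_
  rintro _ (rfl | rfl | rfl | rfl)
  · exact ⟨![true, true, false, false], by ext i; fin_cases i <;> simp [cubeVertex]⟩
  · exact ⟨![false, true, false, false], by ext i; fin_cases i <;> simp [cubeVertex]⟩
  · exact ⟨![true, false, false, false], by ext i; fin_cases i <;> simp [cubeVertex]⟩
  · exact ⟨![false, false, false, false], by ext i; fin_cases i <;> simp [cubeVertex]⟩

lemma finrank_vectorSpan_squareVertices :
    Module.finrank ℝ (vectorSpan ℝ squareVertices) = 2 := by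
  have hparallelogram : !₂[(1 : ℝ), 1, 0, 0] =
      (1 : ℝ) • (!₂[(0 : ℝ), 1, 0, 0] -ᵥ !₂[(0 : ℝ), 0, 0, 0]) +ᵥ !₂[(1 : ℝ), 0, 0, 0] := by
    ext i
    fin_cases i <;> simp
  have hplane : !₂[(1 : ℝ), 1, 0, 0] ∈
      affineSpan ℝ {!₂[(0 : ℝ), 1, 0, 0], !₂[1, 0, 0, 0], !₂[0, 0, 0, 0]} := by
    rw [hparallelogram]
    exact AffineSubspace.smul_vsub_vadd_mem _ _ (mem_affineSpan ℝ (by simp))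
      (mem_affineSpan ℝ (by simp)) (mem_affineSpan ℝ (by simp))
  rw [squareVertices, vectorSpan_insert_eq_vectorSpan hplane,
    finrank_vectorSpan_insert_of_notMem (Set.insert_nonempty _ _) fun h => ?_,
    finrank_vectorSpan_insert_of_notMem (Set.singleton_nonempty _) (by simp),
    vectorSpan_singleton, finrank_bot]
  have := eq_of_mem_affineSpan (EuclideanSpace.projₗ 1) (c := 0) (by simp) h
  simp at this

lemma isQuadrangle_convexHull_squareVertices : IsQuadrangle (convexHull ℝ squareVertices) := by
  refine inConvexPosition_squareVertices.isQuadrangle_convexHull_iff.2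
    ⟨finrank_vectorSpan_squareVertices, ?_⟩
  rw [squareVertices, Set.encard_insert_of_notMem (by simp), Set.encard_insert_of_notMem (by simp),
    Set.encard_pair (by simp)]
  norm_num

theorem exists_isQuadrangle_isTwoFoldPyramid :
    ∃ P Q : Set (EuclideanSpace ℝ (Fin 4)), IsQuadrangle Q ∧ IsTwoFoldPyramid P Q := by
  have hQ := isQuadrangle_convexHull_squareVertices
  obtain ⟨P, hP⟩ := exists_isTwoFoldPyramid (Q := convexHull ℝ squareVertices)
    (by rw [hQ.1.2.2]; norm_num)
  exact ⟨P, _, hQ, hP⟩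

end Existence

end CubicalPolytope

theorem mainTheorem9 :
    (∀ (n : ℕ) (P : Set (EuclideanSpace ℝ (Fin n))),
      CubicalPolytope.IsCubicalDPolytope 4 P → CubicalPolytope.IsStronglyLinked 4 2 P) ∧
    (∀ (n : ℕ) (P Q : Set (EuclideanSpace ℝ (Fin n))),
      CubicalPolytope.IsQuadrangle Q → CubicalPolytope.IsTwoFoldPyramid P Q →
        CubicalPolytope.IsDPolytope 4 P ∧ (CubicalPolytope.vertexSet P).encard = 6 ∧
          ¬ CubicalPolytope.IsStronglyLinked 4 2 P) ∧
    (∃ P Q : Set (EuclideanSpace ℝ (Fin 4)),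
      CubicalPolytope.IsQuadrangle Q ∧ CubicalPolytope.IsTwoFoldPyramid P Q) :=
  ⟨fun _ _ hP => hP.isStronglyLinked, fun _ _ _ hQ hP => hP.not_isStronglyLinked hQ,
    CubicalPolytope.exists_isQuadrangle_isTwoFoldPyramid⟩
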